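/- Let $\theta,\eta\in\mathbb R$ and let $W\in L^\infty(\mathbb R)$ be real-valued, non-negative and of compact support. Let $\mathcal H$ be the operator in the complex Hilbert space $L^2(\mathbb R)$ acting by $\mathcal H\phi=-\phi''+W\phi$ (the derivatives being weak derivatives on $\mathbb R\setminus\{0\}$) on the domain $$\operatorname{dom}\mathcal H=\{\phi\in W^2_2(\mathbb R\setminus\{0\}) : \phi(+0)=\theta\phi(-0),\ \phi'(+0)=\theta^{-1}\phi'(-0)+\eta\phi(-0)\}.$$ Suppose that $\eta\theta<0$ and $$\int_0^{\infty}\bigl(W(-x)+\theta^2W(x)\bigr)\,dx<\frac{|\eta\theta|}{2}.$$ Then $\mathcal H$ has a unique negative eigenvalue. If $W=0$, this eigenvalue equals $-\dfrac{\eta^2\theta^2}{(\theta^2+1)^2}$. -/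

import Mathlib

open MeasureTheory Filter Topology
open scoped ENNReal ContDiff

noncomputable section

namespace PointInteraction

/-- The complex Hilbert space `L²(ℝ)`. -/
abbrev L2 : Type := Lp ℂ 2 (volume : Measure ℝ)

/-- `g` is the weak (distributional) derivative of `f` on `ℝ ∖ {0}`:
`∫ ζ' f = - ∫ ζ g` for every test function `ζ ∈ C_c^∞(ℝ ∖ {0})`. -/
def IsWeakDeriv (f g : L2) : Prop :=
  ∀ ζ : ℝ → ℝ, ContDiff ℝ ∞ ζ → HasCompactSupport ζ → tsupport ζ ⊆ {0}ᶜ →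
    ∫ x, deriv ζ x • f x = -∫ x, ζ x • g x

/-- The one-sided value `f(+0) = a`, as an essential limit, so that it depends only on the class
of `f` modulo null sets; it is the ordinary limit at `+0` of any representative of `f` that is
continuous on `(0, ∞)`. -/
def HasRightValue (f : L2) (a : ℂ) : Prop :=
  Tendsto f (𝓝[>] (0 : ℝ) ⊓ ae volume) (𝓝 a)

/-- The one-sided value `f(-0) = a`, as an essential limit. -/
def HasLeftValue (f : L2) (a : ℂ) : Prop :=
  Tendsto f (𝓝[<] (0 : ℝ) ⊓ ae volume) (𝓝 a)

/-- `φ(+0) = θ φ(-0)` and `φ'(+0) = θ⁻¹ φ'(-0) + η φ(-0)`, where `dφ` is the derivative of `φ`. -/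
def InterfaceConditions (θ η : ℝ) (φ dφ : L2) : Prop :=
  ∃ l r l' r' : ℂ, HasLeftValue φ l ∧ HasRightValue φ r ∧
    HasLeftValue dφ l' ∧ HasRightValue dφ r' ∧
    r = θ * l ∧ r' = (θ : ℂ)⁻¹ * l' + η * l

/-- `φ` lies in `W²₂(ℝ ∖ {0})`, with weak derivatives `φ' = dφ` and `φ'' = ddφ` in `L²(ℝ)`, and
satisfies the interface conditions at the origin. -/
def IsDomainTriple (θ η : ℝ) (φ dφ ddφ : L2) : Prop :=
  IsWeakDeriv φ dφ ∧ IsWeakDeriv dφ ddφ ∧ InterfaceConditions θ η φ dφ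

/-! ### Linearity and uniqueness of weak derivatives -/

theorem integrable_test_smul {ζ : ℝ → ℝ} (h1 : Continuous ζ) (h2 : HasCompactSupport ζ) (f : L2) :
    Integrable (fun x => ζ x • f x) volume :=
  ((Lp.memLp f).locallyIntegrable (by norm_num)).integrable_smul_left_of_hasCompactSupport h1 h2

theorem IsWeakDeriv.add {f g f' g' : L2} (h : IsWeakDeriv f g) (h' : IsWeakDeriv f' g') :
    IsWeakDeriv (f + f') (g + g') := by
  intro ζ h1 h2 h3
  have hc : Continuous (deriv ζ) := h1.continuous_deriv (by simp)
  have e1 : ∫ x, deriv ζ x • (f + f') x = ∫ x, (deriv ζ x • f x + deriv ζ x • f' x) :=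
    integral_congr_ae (by filter_upwards [Lp.coeFn_add f f'] with x hx; rw [hx, Pi.add_apply, smul_add])
  have e2 : ∫ x, ζ x • (g + g') x = ∫ x, (ζ x • g x + ζ x • g' x) :=
    integral_congr_ae (by filter_upwards [Lp.coeFn_add g g'] with x hx; rw [hx, Pi.add_apply, smul_add])
  rw [e1, e2, integral_add (integrable_test_smul hc h2.deriv f)
    (integrable_test_smul hc h2.deriv f'), integral_add (integrable_test_smul h1.continuous h2 g)
    (integrable_test_smul h1.continuous h2 g'), h ζ h1 h2 h3, h' ζ h1 h2 h3]
  ring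

theorem IsWeakDeriv.smul {f g : L2} (c : ℂ) (h : IsWeakDeriv f g) :
    IsWeakDeriv (c • f) (c • g) := by
  intro ζ h1 h2 h3
  have e1 : ∫ x, deriv ζ x • (c • f) x = ∫ x, c * (deriv ζ x • f x) :=
    integral_congr_ae (by
      filter_upwards [Lp.coeFn_smul c f] with x hx; simp [hx, mul_left_comm])
  have e2 : ∫ x, ζ x • (c • g) x = ∫ x, c * (ζ x • g x) :=
    integral_congr_ae (by
      filter_upwards [Lp.coeFn_smul c g] with x hx; simp [hx, mul_left_comm])
  rw [e1, e2, integral_const_mul, integral_const_mul, h ζ h1 h2 h3]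
  ring

theorem isWeakDeriv_zero : IsWeakDeriv 0 0 := by
  intro ζ _ _ _
  have e (u : ℝ → ℝ) : ∫ x, u x • (0 : L2) x = 0 := by
    rw [← integral_zero ℝ ℂ (μ := volume)]
    exact integral_congr_ae (by
      filter_upwards [Lp.coeFn_zero ℂ 2 (volume : Measure ℝ)] with x hx
      rw [hx, Pi.zero_apply, smul_zero])
  rw [e, e, neg_zero]

theorem IsWeakDeriv.unique {f g g' : L2} (h : IsWeakDeriv f g) (h' : IsWeakDeriv f g') :
    g = g' := by
  have hloc (u : L2) : LocallyIntegrable u volume := (Lp.memLp u).locallyIntegrable (by norm_num)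
  have key := isOpen_compl_singleton (x := (0 : ℝ)).ae_eq_zero_of_integral_contDiff_smul_eq_zero
    (f := fun x => g x - g' x) (μ := volume) (((hloc g).sub (hloc g')).locallyIntegrableOn _)
    (fun ζ h1 h2 h3 => by
      simp only [smul_sub]
      rw [integral_sub (integrable_test_smul h1.continuous h2 g)
        (integrable_test_smul h1.continuous h2 g'), sub_eq_zero]
      exact neg_injective ((h ζ h1 h2 h3).symm.trans (h' ζ h1 h2 h3)))
  apply Lp.ext
  have h0 : ∀ᵐ x : ℝ, x ≠ 0 := Measure.ae_ne volume 0
  filter_upwards [key, h0] with x hx hx0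
  exact sub_eq_zero.1 (hx hx0)

theorem InterfaceConditions.add {θ η : ℝ} {φ dφ ψ dψ : L2} (h : InterfaceConditions θ η φ dφ)
    (h' : InterfaceConditions θ η ψ dψ) : InterfaceConditions θ η (φ + ψ) (dφ + dψ) := by
  obtain ⟨l, r, l', r', h1, h2, h3, h4, h5, h6⟩ := h
  obtain ⟨m, s, m', s', k1, k2, k3, k4, k5, k6⟩ := h'
  have key (F : Filter ℝ) (f g : L2) (a b : ℂ) (hf : Tendsto f (F ⊓ ae volume) (𝓝 a))
      (hg : Tendsto g (F ⊓ ae volume) (𝓝 b)) :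
      Tendsto (f + g : L2) (F ⊓ ae volume) (𝓝 (a + b)) :=
    (hf.add hg).congr' (EventuallyEq.filter_mono (Lp.coeFn_add f g).symm inf_le_right)
  refine ⟨l + m, r + s, l' + m', r' + s', key _ _ _ _ _ h1 k1, key _ _ _ _ _ h2 k2,
    key _ _ _ _ _ h3 k3, key _ _ _ _ _ h4 k4, ?_, ?_⟩
  · rw [h5, k5]; ring
  · rw [h6, k6]; ring

theorem InterfaceConditions.smul {θ η : ℝ} {φ dφ : L2} (c : ℂ)
    (h : InterfaceConditions θ η φ dφ) : InterfaceConditions θ η (c • φ) (c • dφ) := by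
  obtain ⟨l, r, l', r', h1, h2, h3, h4, h5, h6⟩ := h
  have key (F : Filter ℝ) (f : L2) (a : ℂ) (hf : Tendsto f (F ⊓ ae volume) (𝓝 a)) :
      Tendsto (c • f : L2) (F ⊓ ae volume) (𝓝 (c * a)) :=
    (hf.const_mul c).congr' (EventuallyEq.filter_mono (Lp.coeFn_smul c f).symm inf_le_right)
  refine ⟨c * l, c * r, c * l', c * r', key _ _ _ h1, key _ _ _ h2, key _ _ _ h3, key _ _ _ h4,
    ?_, ?_⟩
  · rw [h5]; ring
  · rw [h6]; ring

theorem interfaceConditions_zero (θ η : ℝ) : InterfaceConditions θ η 0 0 := by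
  have key (F : Filter ℝ) : Tendsto (0 : L2) (F ⊓ ae volume) (𝓝 0) :=
    tendsto_const_nhds.congr'
      (EventuallyEq.filter_mono (Lp.coeFn_zero ℂ 2 (volume : Measure ℝ)).symm inf_le_right)
  exact ⟨0, 0, 0, 0, key _, key _, key _, key _, by simp, by simp⟩

theorem IsDomainTriple.add {θ η : ℝ} {φ dφ ddφ ψ dψ ddψ : L2} (h : IsDomainTriple θ η φ dφ ddφ)
    (h' : IsDomainTriple θ η ψ dψ ddψ) :
    IsDomainTriple θ η (φ + ψ) (dφ + dψ) (ddφ + ddψ) :=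
  ⟨h.1.add h'.1, h.2.1.add h'.2.1, h.2.2.add h'.2.2⟩

theorem IsDomainTriple.smul {θ η : ℝ} {φ dφ ddφ : L2} (c : ℂ) (h : IsDomainTriple θ η φ dφ ddφ) :
    IsDomainTriple θ η (c • φ) (c • dφ) (c • ddφ) :=
  ⟨h.1.smul c, h.2.1.smul c, h.2.2.smul c⟩

theorem IsDomainTriple.unique {θ η : ℝ} {φ dφ ddφ dφ' ddφ' : L2}
    (h : IsDomainTriple θ η φ dφ ddφ) (h' : IsDomainTriple θ η φ dφ' ddφ') : ddφ = ddφ' := by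
  obtain rfl := h.1.unique h'.1
  exact h.2.1.unique h'.2.1

/-! ### The operator -/

/-- The domain: all `φ ∈ W²₂(ℝ ∖ {0})` with `φ(+0) = θ φ(-0)` and
`φ'(+0) = θ⁻¹ φ'(-0) + η φ(-0)`. -/
def domain (θ η : ℝ) : Submodule ℂ L2 where
  carrier := {φ | ∃ dφ ddφ : L2, IsDomainTriple θ η φ dφ ddφ}
  add_mem' := by
    rintro φ ψ ⟨_, _, h⟩ ⟨_, _, h'⟩
    exact ⟨_, _, h.add h'⟩
  zero_mem' := ⟨0, 0, isWeakDeriv_zero, isWeakDeriv_zero, interfaceConditions_zero θ η⟩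
  smul_mem' := by
    rintro c φ ⟨_, _, h⟩
    exact ⟨_, _, h.smul c⟩

/-- The weak second derivative `φ''` on `ℝ ∖ {0}` of an element of the domain. -/
def secondDeriv {θ η : ℝ} (φ : domain θ η) : L2 := φ.2.choose_spec.choose

theorem secondDeriv_eq {θ η : ℝ} (φ : domain θ η) {dφ ddφ : L2}
    (h : IsDomainTriple θ η φ dφ ddφ) : secondDeriv φ = ddφ :=
  φ.2.choose_spec.choose_spec.unique h

/-- The operator `𝓗 φ = -φ'' + W φ` in `L²(ℝ)` with interface conditions `φ(+0) = θ φ(-0)`,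
`φ'(+0) = θ⁻¹ φ'(-0) + η φ(-0)`, for a real potential `W ∈ L^∞(ℝ)`. -/
def hamiltonian (θ η : ℝ) (W : Lp ℝ ∞ (volume : Measure ℝ)) : L2 →ₗ.[ℂ] L2 where
  domain := domain θ η
  toFun :=
    { toFun := fun φ => -secondDeriv φ + W • (φ : L2)
      map_add' := by
        intro φ ψ
        obtain ⟨_, _, h⟩ := φ.2
        obtain ⟨_, _, h'⟩ := ψ.2
        rw [secondDeriv_eq φ h, secondDeriv_eq ψ h', secondDeriv_eq (φ + ψ) (h.add h'),
          Submodule.coe_add, Lp.add_smul]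
        abel
      map_smul' := by
        intro c φ
        obtain ⟨_, _, h⟩ := φ.2
        rw [secondDeriv_eq φ h, secondDeriv_eq (c • φ) (h.smul c), Submodule.coe_smul,
          RingHom.id_apply, smul_add, smul_neg]
        congr 1
        apply Lp.ext
        filter_upwards [Lp.coeFn_lpSMul (r := 2) W (c • (φ : L2)),
          Lp.coeFn_smul c (W • (φ : L2)), Lp.coeFn_lpSMul (r := 2) W (φ : L2),
          Lp.coeFn_smul c (φ : L2)] with x h1 h2 h3 h4
        rw [h1, h2, Pi.smul_apply', Pi.smul_apply, h3, h4, Pi.smul_apply, Pi.smul_apply',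
          smul_comm] }

/-- `μ` is an eigenvalue of the (unbounded) operator `A`. -/
def IsEigenvalue (A : L2 →ₗ.[ℂ] L2) (μ : ℂ) : Prop :=
  ∃ φ : A.domain, (φ : L2) ≠ 0 ∧ A φ = μ • (φ : L2)

end PointInteraction

end

/-!
The Hamiltonian is the operator of the quadratic form `∫ |φ'|² + ∫ W |φ|² + ηθ |φ(-0)|²` on the
functions `φ ∈ W¹₂(ℝ ∖ {0})` with `φ(+0) = θ φ(-0)`, where `c = -ηθ > 0`. This is a non-negative
form minus `c` times the square of the functional `φ ↦ φ(-0)`, a rank-one perturbation.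

*Uniqueness* (`negative_eigenvalue_unique`). Eigenfunctions `φ, ψ` of two different negative
eigenvalues are orthogonal, so the form is negative on `ψ(-0) φ - φ(-0) ψ`; but this function
vanishes at `-0`, where the form is non-negative.

*Existence* (`exists_negative_eigenvalue`). For `κ > 0` the form
`a(φ, ψ) = ⟪φ', ψ'⟫ + ⟪(W + κ²) φ, ψ⟫` is coercive on the form domain, so the trace functional
`φ ↦ φ(-0)` is represented by a unique `g_κ`, that is, `a(g_κ, ψ) = ψ(-0)`. By Green's formula `g_κ`
is an eigenfunction with eigenvalue `-κ²` as soon as `g_κ(-0) = 1 / c` (`isEigenvalue_of_form_eq`).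
The number `g_κ(-0)` depends continuously on `κ`. The bound `|φ(-0)|² ≤ a(φ, φ) / κ` gives
`g_κ(-0) ≤ 1 / κ`, hence at most `1 / c` for `κ = c`. The trial function `v` equal to `e^{κx}` on the
left and `θ e^{-κx}` on the right has `v(-0) = 1` and
`a(v, v) ≤ κ (1 + θ²) + ∫₀^∞ (W(-x) + θ² W(x)) dx`, which is at most `c` for small `κ`; then
`0 ≤ a(c g_κ - v, c g_κ - v) = c² g_κ(-0) - 2c + a(v, v)` gives `g_κ(-0) ≥ 1 / c`. The intermediate
value theorem applies (`exists_solution_inner_eq_inv`).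

When `W = 0` the trial function with `κ = c / (θ² + 1)` is itself an eigenfunction.

The analytic input is the du Bois-Reymond lemma (`IsWeakDeriv.exists_isPrimitive`): a function with
a weak derivative in `L²` agrees, on each half-line, with a primitive of that derivative. It gives
the one-sided values and Green's formula (`IsWeakDeriv.green`). Pairing with one-sided exponentials
in Green's formula expresses the one-sided values as bounded functionals of `(φ, φ')`, which makes
the form domain a closed subspace of `L² × L²`.
-/

noncomputable section

namespace PointInteraction

/-! ### Primitives of locally integrable functions -/

/-- `F` is a primitive of the locally integrable function `f`; equivalently, `F` is locally
absolutely continuous with almost everywhere derivative `f`. -/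
structure IsPrimitive (F f : ℝ → ℂ) : Prop where
  locallyIntegrable : LocallyIntegrable f volume
  integral_eq : ∀ a b : ℝ, ∫ t in a..b, f t = F b - F a

theorem IsPrimitive.intervalIntegrable {F f : ℝ → ℂ} (h : IsPrimitive F f) (a b : ℝ) :
    IntervalIntegrable f volume a b :=
  (h.locallyIntegrable.integrableOn_isCompact isCompact_uIcc).intervalIntegrable

theorem IsPrimitive.eq_add {F f : ℝ → ℂ} (h : IsPrimitive F f) (a x : ℝ) :
    F x = F a + ∫ t in a..x, f t := by
  rw [h.integral_eq]; ring

theorem IsPrimitive.continuous {F f : ℝ → ℂ} (h : IsPrimitive F f) : Continuous F := by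
  have : F = fun x => F 0 + ∫ t in (0 : ℝ)..x, f t := funext fun x => h.eq_add 0 x
  rw [this]
  exact continuous_const.add (intervalIntegral.continuous_primitive h.intervalIntegrable 0)

theorem isPrimitive_integral {f : ℝ → ℂ} (hf : LocallyIntegrable f volume) (c : ℂ) :
    IsPrimitive (fun x => c + ∫ t in (0 : ℝ)..x, f t) f := by
  refine ⟨hf, fun a b => ?_⟩
  have hi (a b : ℝ) : IntervalIntegrable f volume a b :=
    (hf.integrableOn_isCompact isCompact_uIcc).intervalIntegrable
  have := intervalIntegral.integral_add_adjacent_intervals (hi 0 a) (hi a b)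
  rw [← this]; ring

theorem IsPrimitive.add_const {F f : ℝ → ℂ} (h : IsPrimitive F f) (c : ℂ) :
    IsPrimitive (fun x => F x + c) f :=
  ⟨h.locallyIntegrable, fun a b => by rw [h.integral_eq]; ring⟩

theorem isPrimitive_of_hasDerivAt {F f : ℝ → ℂ} (h : ∀ x, HasDerivAt F (f x) x)
    (hf : Continuous f) : IsPrimitive F f :=
  ⟨hf.locallyIntegrable, fun a b => intervalIntegral.integral_eq_sub_of_hasDerivAt
    (fun x _ => h x) (hf.intervalIntegrable a b)⟩

theorem IsPrimitive.conj {F f : ℝ → ℂ} (h : IsPrimitive F f) :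
    IsPrimitive (fun x => (starRingEnd ℂ) (F x)) (fun x => (starRingEnd ℂ) (f x)) := by
  refine ⟨?_, fun a b => ?_⟩
  · intro x
    obtain ⟨s, hs, hi⟩ := h.locallyIntegrable x
    exact ⟨s, hs, Complex.conjCLE.toContinuousLinearMap.integrable_comp hi⟩
  · have := Complex.conjCLE.toContinuousLinearMap.intervalIntegral_comp_comm
      (h.intervalIntegrable a b)
    simp only [ContinuousLinearEquiv.coe_coe, Complex.conjCLE_apply] at this
    rw [this, h.integral_eq, map_sub]

theorem absolutelyContinuousOnInterval_const (c : ℂ) (a b : ℝ) :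
    AbsolutelyContinuousOnInterval (fun _ => c) a b :=
  (LipschitzWith.const c).lipschitzOnWith.absolutelyContinuousOnInterval (K := 0)

/-- The complex-valued case of
`IntervalIntegrable.absolutelyContinuousOnInterval_intervalIntegral`, from real and imaginary
parts. -/
theorem absolutelyContinuousOnInterval_integral {f : ℝ → ℂ} {a b : ℝ}
    (hf : IntervalIntegrable f volume a b) :
    AbsolutelyContinuousOnInterval (fun x => ∫ t in a..x, f t) a b := by
  have hre : IntervalIntegrable (fun t => (f t).re) volume a b :=
    ⟨hf.1.re, hf.2.re⟩
  have him : IntervalIntegrable (fun t => (f t).im) volume a b :=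
    ⟨hf.1.im, hf.2.im⟩
  have h1 := (hre.absolutelyContinuousOnInterval_intervalIntegral (c := a) (by simp)).fun_smul
    (absolutelyContinuousOnInterval_const 1 a b)
  have h2 := (him.absolutelyContinuousOnInterval_intervalIntegral (c := a) (by simp)).fun_smul
    (absolutelyContinuousOnInterval_const Complex.I a b)
  have h3 := h1.fun_add h2
  have key : ∀ x ∈ Set.uIcc a b, (∫ t in a..x, (f t).re) • (1 : ℂ) +
      (∫ t in a..x, (f t).im) • Complex.I = ∫ t in a..x, f t := by
    intro x hx
    have hfx : IntervalIntegrable f volume a x :=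
      hf.mono_set (Set.uIcc_subset_uIcc_left hx)
    have e1 := Complex.reCLM.intervalIntegral_comp_comm hfx
    have e2 := Complex.imCLM.intervalIntegral_comp_comm hfx
    simp only [Complex.reCLM_apply, Complex.imCLM_apply] at e1 e2
    rw [e1, e2]
    apply Complex.ext <;> simp
  rw [absolutelyContinuousOnInterval_iff] at h3 ⊢
  intro ε hε
  obtain ⟨δ, hδ, h⟩ := h3 ε hε
  refine ⟨δ, hδ, fun E hE hlt => ?_⟩
  refine lt_of_eq_of_lt (Finset.sum_congr rfl fun i hi => ?_) (h E hE hlt)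
  obtain ⟨k1, k2⟩ := hE.1 i hi
  rw [key _ k1, key _ k2]

/-- Leibniz rule. The difference of `F G` and the integral of `f G + F g` is absolutely continuous
with almost everywhere vanishing derivative, hence constant. -/
theorem IsPrimitive.mul {F f G g : ℝ → ℂ} (hF : IsPrimitive F f) (hG : IsPrimitive G g) :
    IsPrimitive (fun x => F x * G x) (fun x => f x * G x + F x * g x) := by
  have hloc : LocallyIntegrable (fun x => f x * G x + F x * g x) volume := by
    have h1 : LocallyIntegrable (fun x => G x • f x) volume :=
      hF.locallyIntegrable.continuous_smul hG.continuous
    have h2 : LocallyIntegrable (fun x => F x • g x) volume :=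
      hG.locallyIntegrable.continuous_smul hF.continuous
    refine (h1.add h2).congr (Eventually.of_forall fun x => ?_)
    simp [mul_comm]
  refine ⟨hloc, fun a b => ?_⟩
  have hi : IntervalIntegrable (fun x => f x * G x + F x * g x) volume a b :=
    (hloc.integrableOn_isCompact isCompact_uIcc).intervalIntegrable
  have aF := (absolutelyContinuousOnInterval_const (F a) a b).fun_add
    (absolutelyContinuousOnInterval_integral (hF.intervalIntegrable a b))
  have aG := (absolutelyContinuousOnInterval_const (G a) a b).fun_add
    (absolutelyContinuousOnInterval_integral (hG.intervalIntegrable a b))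
  simp only [← hF.eq_add a] at aF
  simp only [← hG.eq_add a] at aG
  have aH := (aF.fun_smul aG).fun_sub (absolutelyContinuousOnInterval_integral hi)
  obtain ⟨C, hC⟩ := aH.const_of_ae_hasDerivAt_zero (by
    filter_upwards [(hF.intervalIntegrable a b).ae_hasDerivAt_integral,
      (hG.intervalIntegrable a b).ae_hasDerivAt_integral, hi.ae_hasDerivAt_integral]
      with x h1 h2 h3 hx
    have d1 := (h1 hx a (by simp)).const_add (F a)
    have d2 := (h2 hx a (by simp)).const_add (G a)
    simp only [← hF.eq_add a] at d1
    simp only [← hG.eq_add a] at d2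
    convert! (d1.mul d2).sub (h3 hx a (by simp)) using 1
    ring)
  have e1 := hC a (by simp)
  have e2 := hC b (by simp)
  simp only [smul_eq_mul, intervalIntegral.integral_same, sub_zero] at e1 e2
  rw [e1, ← e2]; ring

/-- There is no boundary term at infinity: `F` has a limit there because `f` is integrable, and the
limit is zero because `F` is integrable. -/
theorem IsPrimitive.integral_Ioi {F f : ℝ → ℂ} (h : IsPrimitive F f)
    (hf : IntegrableOn f (Set.Ioi 0)) (hF : IntegrableOn F (Set.Ioi 0)) :
    ∫ x in Set.Ioi (0 : ℝ), f x = -F 0 := by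
  have h1 := intervalIntegral_tendsto_integral_Ioi 0 hf tendsto_id
  have h2 : Tendsto F atTop (𝓝 (F 0 + ∫ x in Set.Ioi (0 : ℝ), f x)) := by
    refine (h1.const_add (F 0)).congr fun x => ?_
    exact (h.eq_add 0 x).symm
  have h3 := IntegrableAtFilter.eq_zero_of_tendsto (μ := volume)
    ⟨Set.Ioi 0, Ioi_mem_atTop 0, hF⟩ (by
      intro s hs
      obtain ⟨b, hb⟩ := mem_atTop_sets.1 hs
      exact measure_mono_top (s₂ := s) (s₁ := Set.Ici b) (fun x hx => hb x hx) Real.volume_Ici) h2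
  linear_combination h3

theorem IsPrimitive.integral_Iic {F f : ℝ → ℂ} (h : IsPrimitive F f)
    (hf : IntegrableOn f (Set.Iic 0)) (hF : IntegrableOn F (Set.Iic 0)) :
    ∫ x in Set.Iic (0 : ℝ), f x = F 0 := by
  have h1 := intervalIntegral_tendsto_integral_Iic 0 hf tendsto_id
  have h2 : Tendsto F atBot (𝓝 (F 0 - ∫ x in Set.Iic (0 : ℝ), f x)) := by
    refine (h1.const_sub (F 0)).congr fun x => ?_
    simp only [id, h.integral_eq]; ring
  have h3 := IntegrableAtFilter.eq_zero_of_tendsto (μ := volume)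
    ⟨Set.Iic 0, Iic_mem_atBot 0, hF⟩ (by
      intro s hs
      obtain ⟨b, hb⟩ := mem_atBot_sets.1 hs
      exact measure_mono_top (s₂ := s) (s₁ := Set.Iic b) (fun x hx => hb x hx) Real.volume_Iic) h2
  linear_combination -h3

/-- The primitive of a test function of zero mean supported in an interval is a test function
supported in the same interval. -/
theorem exists_test_primitive {I : Set ℝ} (hI : I.OrdConnected) {ψ : ℝ → ℝ} (h1 : ContDiff ℝ ∞ ψ)
    (h2 : HasCompactSupport ψ) (h3 : tsupport ψ ⊆ I) (h0 : ∫ x, ψ x = 0) :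
    ∃ χ : ℝ → ℝ, ContDiff ℝ ∞ χ ∧ HasCompactSupport χ ∧ tsupport χ ⊆ I ∧ deriv χ = ψ := by
  rcases (tsupport ψ).eq_empty_or_nonempty with he | hne
  · rw [tsupport_eq_empty_iff] at he
    exact ⟨0, contDiff_const, HasCompactSupport.zero, by simp [tsupport_eq_empty_iff.2 rfl], by simp [he]⟩
  have hK : IsCompact (tsupport ψ) := h2
  set a := sInf (tsupport ψ)
  set b := sSup (tsupport ψ)
  have ha : a ∈ tsupport ψ := hK.sInf_mem hne
  have hb : b ∈ tsupport ψ := hK.sSup_mem hne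
  have hab : Set.Icc a b ⊆ I := hI.out (h3 ha) (h3 hb)
  have hsub : tsupport ψ ⊆ Set.Icc a b := fun x hx =>
    ⟨csInf_le hK.bddBelow hx, le_csSup hK.bddAbove hx⟩
  have hzero : ∀ x, x ∉ Set.Icc a b → ψ x = 0 := fun x hx =>
    image_eq_zero_of_notMem_tsupport fun h => hx (hsub h)
  have hd : ∀ x, HasDerivAt (fun x => ∫ t in (a - 1)..x, ψ t) (ψ x) x := fun x =>
    intervalIntegral.integral_hasDerivAt_right (h1.continuous.intervalIntegrable _ _)
      (h1.continuous.stronglyMeasurableAtFilter _ _) h1.continuous.continuousAt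
  have hderiv : deriv (fun x => ∫ t in (a - 1)..x, ψ t) = ψ := funext fun x => (hd x).deriv
  have hsupp : Function.support (fun x => ∫ t in (a - 1)..x, ψ t) ⊆ Set.Icc a b := by
    intro x hx
    by_contra hxI
    apply hx
    rcases lt_or_ge x a with hxa | hxa
    · refine (intervalIntegral.integral_congr (g := fun _ => (0 : ℝ)) fun t ht => ?_).trans (by simp)
      apply hzero
      intro h
      have := Set.mem_uIcc.1 ht
      rcases this with h' | h' <;> linarith [h.1]
    · have hxb : b < x := lt_of_not_ge fun h => hxI ⟨hxa, h⟩
      show ∫ t in (a - 1)..x, ψ t = 0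
      rw [intervalIntegral.integral_eq_integral_of_support_subset, h0]
      intro t ht
      have := hsub (subset_tsupport _ ht)
      exact ⟨by linarith [this.1], by linarith [this.2]⟩
  have hts := closure_minimal hsupp isClosed_Icc
  refine ⟨fun x => ∫ t in (a - 1)..x, ψ t, ?_,
    isCompact_Icc.of_isClosed_subset (isClosed_tsupport _) hts, hts.trans hab, hderiv⟩
  rw [contDiff_infty_iff_deriv, hderiv]
  exact ⟨fun x => (hd x).differentiableAt, h1⟩

/-- A primitive in the sense of `IsPrimitive` is also one in the sense of distributions. -/
theorem IsPrimitive.integral_test {F f : ℝ → ℂ} (h : IsPrimitive F f) {ζ : ℝ → ℝ}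
    (h1 : ContDiff ℝ ∞ ζ) (h2 : HasCompactSupport ζ) :
    ∫ x, deriv ζ x • F x = -∫ x, ζ x • f x := by
  have hζ : IsPrimitive (fun x => (ζ x : ℂ)) (fun x => ((deriv ζ x : ℝ) : ℂ)) :=
    isPrimitive_of_hasDerivAt
      (fun x => (h1.differentiable (by simp) x).hasDerivAt.ofReal_comp)
      (Complex.continuous_ofReal.comp (h1.continuous_deriv (by simp)))
  have hm := hζ.mul h
  have i1 : Integrable (fun x => deriv ζ x • F x) :=
    h.continuous.locallyIntegrable.integrable_smul_left_of_hasCompactSupport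
      (h1.continuous_deriv (by simp)) h2.deriv
  have i2 : Integrable (fun x => ζ x • f x) :=
    h.locallyIntegrable.integrable_smul_left_of_hasCompactSupport h1.continuous h2
  rw [eq_neg_iff_add_eq_zero, ← integral_add i1 i2]
  obtain ⟨R, hR⟩ := h2.isBounded.subset_ball 0
  have hout : ∀ x, R ≤ |x| → x ∉ tsupport ζ := fun x hx hx' => by
    have := hR hx'
    simp only [Metric.mem_ball, dist_zero_right, Real.norm_eq_abs] at this
    linarith
  have hz : ∀ x, R ≤ |x| → ζ x = 0 := fun x hx => image_eq_zero_of_notMem_tsupport (hout x hx)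
  have hz' : ∀ x, R ≤ |x| → deriv ζ x = 0 := fun x hx =>
    image_eq_zero_of_notMem_tsupport fun h' => hout x hx (tsupport_deriv_subset (𝕜 := ℝ) h')
  have hsub : Function.support (fun x => deriv ζ x • F x + ζ x • f x) ⊆ Set.Ioc (-|R|) |R| := by
    intro x hx
    by_contra hxI
    apply hx
    have : R ≤ |x| := by
      by_contra hlt
      push Not at hlt
      have := abs_lt.1 (hlt.trans_le (le_abs_self R))
      exact hxI ⟨this.1, this.2.le⟩
    simp [hz x this, hz' x this]
  rw [← intervalIntegral.integral_eq_integral_of_support_subset hsub]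
  have := hm.integral_eq (-|R|) |R|
  rw [hz |R| (by simpa using le_abs_self R), hz (-|R|) (by simpa using le_abs_self R)] at this
  simpa using this

/-- **Du Bois-Reymond lemma**: on an open interval avoiding the origin, a function with a weak
derivative in `L²` agrees almost everywhere with a primitive of that derivative. -/
theorem IsWeakDeriv.exists_isPrimitive {f g : L2} (h : IsWeakDeriv f g) {I : Set ℝ}
    (hI : I.OrdConnected) (hIo : IsOpen I) (hI0 : I ⊆ {0}ᶜ) (hne : I.Nonempty) :
    ∃ F : ℝ → ℂ, IsPrimitive F g ∧ ∀ᵐ x : ℝ, x ∈ I → f x = F x := by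
  have hloc (u : L2) : LocallyIntegrable u volume := (Lp.memLp u).locallyIntegrable (by norm_num)
  have hF := isPrimitive_integral (hloc g) 0
  set F : ℝ → ℂ := fun x => 0 + ∫ t in (0 : ℝ)..x, g t
  -- a test function of integral one, supported in the interval
  obtain ⟨p, hp⟩ := hne
  obtain ⟨r, hr, hrI⟩ := Metric.isOpen_iff.1 hIo p hp
  let B : ContDiffBump p := ⟨r / 4, r / 2, by positivity, by linarith⟩
  let ρ : ℝ → ℝ := B.normed volume
  have ρ1 : ContDiff ℝ ∞ ρ := B.contDiff_normed
  have ρ2 : HasCompactSupport ρ := B.hasCompactSupport_normed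
  have ρ3 : tsupport ρ ⊆ I := by
    rw [B.tsupport_normed_eq]
    exact (Metric.closedBall_subset_ball (by simp [B]; linarith)).trans hrI
  have ρ4 : ∫ x, ρ x = 1 := B.integral_normed
  have hint (ζ : ℝ → ℝ) (h1 : ContDiff ℝ ∞ ζ) (h2 : HasCompactSupport ζ) :
      Integrable (fun x => ζ x • (f x - F x)) volume :=
    ((hloc f).sub hF.continuous.locallyIntegrable).integrable_smul_left_of_hasCompactSupport
      h1.continuous h2
  set C : ℂ := ∫ x, ρ x • (f x - F x)
  refine ⟨_, hF.add_const C, ?_⟩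
  have key := hIo.ae_eq_zero_of_integral_contDiff_smul_eq_zero
    (f := fun x => f x - F x - C) (μ := volume)
    ((((hloc f).sub hF.continuous.locallyIntegrable).sub
      (continuous_const.locallyIntegrable)).locallyIntegrableOn _) ?_
  · filter_upwards [key] with x hx hxI
    linear_combination hx hxI
  intro ζ z1 z2 z3
  -- subtracting `m ρ` makes the mean of `ζ` zero, so that the result has a test primitive
  set m : ℝ := ∫ x, ζ x
  have ψ1 : ContDiff ℝ ∞ (fun x => ζ x - m * ρ x) := z1.sub (contDiff_const.mul ρ1)
  have ψ2 : HasCompactSupport (fun x => ζ x - m * ρ x) := by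
    simpa using! z2.sub (ρ2.mul_left (f := fun _ => m))
  have ψ3 : tsupport (fun x => ζ x - m * ρ x) ⊆ I := by
    refine (tsupport_sub ζ (fun x => m * ρ x)).trans (Set.union_subset z3 ?_)
    exact (tsupport_mul_subset_right (f := fun _ => m) (g := ρ)).trans ρ3
  have ψ0 : ∫ x, (ζ x - m * ρ x) = 0 := by
    rw [integral_sub (z1.continuous.integrable_of_hasCompactSupport z2)
      ((ρ1.continuous.integrable_of_hasCompactSupport ρ2).const_mul m), integral_const_mul, ρ4]
    simp [m]
  obtain ⟨χ, χ1, χ2, χ3, χ4⟩ := exists_test_primitive hI ψ1 ψ2 ψ3 ψ0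
  have e1 := h χ χ1 χ2 (χ3.trans hI0)
  have e2 := hF.integral_test χ1 χ2
  rw [← e2, χ4] at e1
  have iψ (u : ℝ → ℂ) (hu : LocallyIntegrable u volume) :
      Integrable (fun x => (ζ x - m * ρ x) • u x) volume :=
    hu.integrable_smul_left_of_hasCompactSupport ψ1.continuous ψ2
  rw [← sub_eq_zero, ← integral_sub (iψ _ (hloc f)) (iψ _ hF.continuous.locallyIntegrable)] at e1
  have e3 : ∫ x, (ζ x • (f x - F x) - m • (ρ x • (f x - F x))) = 0 := by
    rw [← e1]
    congr 1; ext x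
    simp only [Complex.real_smul]; push_cast; ring
  have iρ : Integrable (fun x => m • (ρ x • (f x - F x))) volume := (hint ρ ρ1 ρ2).smul m
  rw [integral_sub (hint ζ z1 z2) iρ, integral_smul] at e3
  have e4 : ∫ x, ζ x • (f x - F x - C) = ∫ x, (ζ x • (f x - F x) - ζ x • C) := by
    congr 1; ext x; rw [smul_sub]
  rw [e4, integral_sub (hint ζ z1 z2)
    ((z1.continuous.integrable_of_hasCompactSupport z2).smul_const C), integral_smul_const]
  exact e3

/-! ### One-sided values and Green's formula -/

theorem hasRightValue_of_ae_eq {f : L2} {F : ℝ → ℂ} (hF : Continuous F)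
    (h : ∀ᵐ x : ℝ, x ∈ Set.Ioi (0 : ℝ) → f x = F x) : HasRightValue f (F 0) := by
  have h1 : Tendsto F (𝓝[>] (0 : ℝ) ⊓ ae volume) (𝓝 (F 0)) :=
    (hF.tendsto 0).mono_left (inf_le_left.trans nhdsWithin_le_nhds)
  refine h1.congr' ?_
  filter_upwards [inf_le_left (a := 𝓝[>] (0 : ℝ)) (b := ae volume) self_mem_nhdsWithin,
    inf_le_right (a := 𝓝[>] (0 : ℝ)) (b := ae volume) h] with x h0 hx
  exact (hx h0).symm

theorem hasLeftValue_of_ae_eq {f : L2} {F : ℝ → ℂ} (hF : Continuous F)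
    (h : ∀ᵐ x : ℝ, x ∈ Set.Iio (0 : ℝ) → f x = F x) : HasLeftValue f (F 0) := by
  have h1 : Tendsto F (𝓝[<] (0 : ℝ) ⊓ ae volume) (𝓝 (F 0)) :=
    (hF.tendsto 0).mono_left (inf_le_left.trans nhdsWithin_le_nhds)
  refine h1.congr' ?_
  filter_upwards [inf_le_left (a := 𝓝[<] (0 : ℝ)) (b := ae volume) self_mem_nhdsWithin,
    inf_le_right (a := 𝓝[<] (0 : ℝ)) (b := ae volume) h] with x h0 hx
  exact (hx h0).symm

theorem HasRightValue.unique {f : L2} {a b : ℂ} (ha : HasRightValue f a)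
    (hb : HasRightValue f b) : a = b := by
  have : NeBot (𝓝[>] (0 : ℝ) ⊓ ae volume) := by
    rw [inf_neBot_iff]
    intro s hs t ht
    obtain ⟨u, hu, hus⟩ := mem_nhdsGT_iff_exists_Ioo_subset.1 hs
    by_contra hne
    have hsub : Set.Ioo 0 u ⊆ tᶜ := fun x hx hxt => hne ⟨x, hus hx, hxt⟩
    have h0 : volume (Set.Ioo 0 u) = 0 := measure_mono_null hsub (mem_ae_iff.1 ht)
    rw [Real.volume_Ioo, ENNReal.ofReal_eq_zero] at h0
    have : (0 : ℝ) < u := hu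
    linarith
  exact tendsto_nhds_unique ha hb

theorem HasLeftValue.unique {f : L2} {a b : ℂ} (ha : HasLeftValue f a)
    (hb : HasLeftValue f b) : a = b := by
  have : NeBot (𝓝[<] (0 : ℝ) ⊓ ae volume) := by
    rw [inf_neBot_iff]
    intro s hs t ht
    obtain ⟨u, hu, hus⟩ := mem_nhdsLT_iff_exists_Ioo_subset.1 hs
    by_contra hne
    have hsub : Set.Ioo u 0 ⊆ tᶜ := fun x hx hxt => hne ⟨x, hus hx, hxt⟩
    have h0 : volume (Set.Ioo u 0) = 0 := measure_mono_null hsub (mem_ae_iff.1 ht)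
    rw [Real.volume_Ioo, ENNReal.ofReal_eq_zero] at h0
    have : u < (0 : ℝ) := hu
    linarith
  exact tendsto_nhds_unique ha hb

theorem IsWeakDeriv.exists_right {f f' : L2} (h : IsWeakDeriv f f') :
    ∃ F : ℝ → ℂ, IsPrimitive F f' ∧ ∀ᵐ x : ℝ, x ∈ Set.Ioi (0 : ℝ) → f x = F x :=
  h.exists_isPrimitive Set.ordConnected_Ioi isOpen_Ioi (fun _ hx => ne_of_gt hx) ⟨1, Set.mem_Ioi.2 one_pos⟩

theorem IsWeakDeriv.exists_left {f f' : L2} (h : IsWeakDeriv f f') :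
    ∃ F : ℝ → ℂ, IsPrimitive F f' ∧ ∀ᵐ x : ℝ, x ∈ Set.Iio (0 : ℝ) → f x = F x :=
  h.exists_isPrimitive Set.ordConnected_Iio isOpen_Iio (fun _ hx => ne_of_lt hx)
    ⟨-1, Set.mem_Iio.2 neg_one_lt_zero⟩

theorem IsWeakDeriv.exists_hasRightValue {f f' : L2} (h : IsWeakDeriv f f') :
    ∃ a, HasRightValue f a :=
  let ⟨F, hF, hf⟩ := h.exists_right
  ⟨F 0, hasRightValue_of_ae_eq hF.continuous hf⟩

theorem IsWeakDeriv.exists_hasLeftValue {f f' : L2} (h : IsWeakDeriv f f') :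
    ∃ a, HasLeftValue f a :=
  let ⟨F, hF, hf⟩ := h.exists_left
  ⟨F 0, hasLeftValue_of_ae_eq hF.continuous hf⟩

/-- A function that is a primitive of `f'` on each side of the origin, with no condition at the
origin itself, has the weak derivative `f'` on `ℝ ∖ {0}`. -/
theorem isWeakDeriv_of_isPrimitive {f f' : L2} {P p N n : ℝ → ℂ}
    (hP : IsPrimitive P p) (hN : IsPrimitive N n)
    (hfP : ∀ᵐ x : ℝ, x ∈ Set.Ioi (0 : ℝ) → f x = P x ∧ f' x = p x)
    (hfN : ∀ᵐ x : ℝ, x ∈ Set.Iio (0 : ℝ) → f x = N x ∧ f' x = n x) : IsWeakDeriv f f' := by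
  intro ζ h1 h2 h3
  have hc : Continuous (deriv ζ) := h1.continuous_deriv (by simp)
  have i1 := integrable_test_smul hc h2.deriv f
  have i2 := integrable_test_smul h1.continuous h2 f'
  have hζ0 : ζ 0 = 0 := image_eq_zero_of_notMem_tsupport fun h => h3 h rfl
  have hζ : IsPrimitive (fun x => (ζ x : ℂ)) (fun x => ((deriv ζ x : ℝ) : ℂ)) :=
    isPrimitive_of_hasDerivAt
      (fun x => (h1.differentiable (by simp) x).hasDerivAt.ofReal_comp)
      (Complex.continuous_ofReal.comp hc)
  have aux {Q q : ℝ → ℂ} (hQ : IsPrimitive Q q) :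
      Integrable (fun x => (ζ x : ℂ) * Q x) volume ∧
      Integrable (fun x => ((deriv ζ x : ℝ) : ℂ) * Q x + ζ x * q x) volume :=
    ⟨hQ.continuous.locallyIntegrable.integrable_smul_left_of_hasCompactSupport h1.continuous h2,
      (hQ.continuous.locallyIntegrable.integrable_smul_left_of_hasCompactSupport hc h2.deriv).add
        (hQ.locallyIntegrable.integrable_smul_left_of_hasCompactSupport h1.continuous h2)⟩
  have i3 : Integrable (fun x => deriv ζ x • f x + ζ x • f' x) volume := i1.add i2
  rw [eq_neg_iff_add_eq_zero, ← integral_add i1 i2,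
    ← intervalIntegral.integral_Iic_add_Ioi (b := 0) i3.integrableOn i3.integrableOn,
    integral_Iic_eq_integral_Iio]
  have e1 := (hζ.mul hP).integral_Ioi (aux hP).2.integrableOn (aux hP).1.integrableOn
  have e2 := (hζ.mul hN).integral_Iic (aux hN).2.integrableOn (aux hN).1.integrableOn
  rw [integral_Iic_eq_integral_Iio] at e2
  have c1 : ∫ x in Set.Ioi (0 : ℝ), (deriv ζ x • f x + ζ x • f' x) =
      ∫ x in Set.Ioi (0 : ℝ), (((deriv ζ x : ℝ) : ℂ) * P x + ζ x * p x) :=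
    setIntegral_congr_ae measurableSet_Ioi (by
      filter_upwards [hfP] with x hx h0
      simp [hx h0])
  have c2 : ∫ x in Set.Iio (0 : ℝ), (deriv ζ x • f x + ζ x • f' x) =
      ∫ x in Set.Iio (0 : ℝ), (((deriv ζ x : ℝ) : ℂ) * N x + ζ x * n x) :=
    setIntegral_congr_ae measurableSet_Iio (by
      filter_upwards [hfN] with x hx h0
      simp [hx h0])
  rw [c1, c2, e1, e2]
  simp [hζ0]

/-- **Green's formula** on `ℝ ∖ {0}`. -/
theorem IsWeakDeriv.green {f f' g g' : L2} (hf : IsWeakDeriv f f') (hg : IsWeakDeriv g g')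
    {fl fr gl gr : ℂ} (hfl : HasLeftValue f fl) (hfr : HasRightValue f fr)
    (hgl : HasLeftValue g gl) (hgr : HasRightValue g gr) :
    inner ℂ g' f + inner ℂ g f' = (starRingEnd ℂ) gl * fl - (starRingEnd ℂ) gr * fr := by
  obtain ⟨P, hP, hfP⟩ := hf.exists_right
  obtain ⟨N, hN, hfN⟩ := hf.exists_left
  obtain ⟨Q, hQ, hgQ⟩ := hg.exists_right
  obtain ⟨M, hM, hgM⟩ := hg.exists_left
  obtain rfl := hfr.unique (hasRightValue_of_ae_eq hP.continuous hfP)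
  obtain rfl := hfl.unique (hasLeftValue_of_ae_eq hN.continuous hfN)
  obtain rfl := hgr.unique (hasRightValue_of_ae_eq hQ.continuous hgQ)
  obtain rfl := hgl.unique (hasLeftValue_of_ae_eq hM.continuous hgM)
  have i0 : Integrable (fun x => inner ℂ (g x) (f x)) volume := L2.integrable_inner g f
  have i1 : Integrable (fun x => inner ℂ (g' x) (f x)) volume := L2.integrable_inner g' f
  have i2 : Integrable (fun x => inner ℂ (g x) (f' x)) volume := L2.integrable_inner g f'
  have i3 : Integrable (fun x => inner ℂ (g' x) (f x) + inner ℂ (g x) (f' x)) volume := i1.add i2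
  rw [L2.inner_def, L2.inner_def, ← integral_add i1 i2,
    ← intervalIntegral.integral_Iic_add_Ioi (b := 0) i3.integrableOn i3.integrableOn,
    integral_Iic_eq_integral_Iio]
  have a1 : ∀ᵐ x : ℝ, x ∈ Set.Ioi (0 : ℝ) → inner ℂ (g' x) (f x) + inner ℂ (g x) (f' x) =
      (starRingEnd ℂ) (g' x) * P x + (starRingEnd ℂ) (Q x) * f' x := by
    filter_upwards [hfP, hgQ] with x h1 h2 h0
    rw [h1 h0, h2 h0, RCLike.inner_apply', RCLike.inner_apply']
  have a2 : ∀ᵐ x : ℝ, x ∈ Set.Iio (0 : ℝ) → inner ℂ (g' x) (f x) + inner ℂ (g x) (f' x) =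
      (starRingEnd ℂ) (g' x) * N x + (starRingEnd ℂ) (M x) * f' x := by
    filter_upwards [hfN, hgM] with x h1 h2 h0
    rw [h1 h0, h2 h0, RCLike.inner_apply', RCLike.inner_apply']
  have b1 : ∀ᵐ x : ℝ, x ∈ Set.Ioi (0 : ℝ) → inner ℂ (g x) (f x) =
      (starRingEnd ℂ) (Q x) * P x := by
    filter_upwards [hfP, hgQ] with x h1 h2 h0
    rw [h1 h0, h2 h0, RCLike.inner_apply']
  have b2 : ∀ᵐ x : ℝ, x ∈ Set.Iio (0 : ℝ) → inner ℂ (g x) (f x) =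
      (starRingEnd ℂ) (M x) * N x := by
    filter_upwards [hfN, hgM] with x h1 h2 h0
    rw [h1 h0, h2 h0, RCLike.inner_apply']
  have e1 := (hQ.conj.mul hP).integral_Ioi
    (i3.integrableOn.congr_fun_ae ((ae_restrict_iff' measurableSet_Ioi).2 a1))
    (i0.integrableOn.congr_fun_ae ((ae_restrict_iff' measurableSet_Ioi).2 b1))
  have e2 := (hM.conj.mul hN).integral_Iic
    ((integrableOn_Iic_iff_integrableOn_Iio).2
      (i3.integrableOn.congr_fun_ae ((ae_restrict_iff' measurableSet_Iio).2 a2)))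
    ((integrableOn_Iic_iff_integrableOn_Iio).2
      (i0.integrableOn.congr_fun_ae ((ae_restrict_iff' measurableSet_Iio).2 b2)))
  rw [integral_Iic_eq_integral_Iio] at e2
  rw [setIntegral_congr_ae measurableSet_Ioi a1, setIntegral_congr_ae measurableSet_Iio a2, e1, e2]
  ring

/-! ### Exponentials on the two half-lines -/

/-- The function `a e^{κx}` for `x ≤ 0`, `b e^{-κx}` for `x > 0`. -/
def twoSidedExpFun (κ a b : ℝ) (x : ℝ) : ℂ :=
  if 0 < x then ((b * Real.exp (-κ * x) : ℝ) : ℂ) else ((a * Real.exp (κ * x) : ℝ) : ℂ)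

theorem memLp_twoSidedExpFun {κ : ℝ} (hκ : 0 < κ) (a b : ℝ) :
    MemLp (twoSidedExpFun κ a b) 2 (volume : Measure ℝ) := by
  have hm : Measurable (twoSidedExpFun κ a b) :=
    Measurable.ite measurableSet_Ioi (by fun_prop) (by fun_prop)
  rw [memLp_two_iff_integrable_sq_norm hm.aestronglyMeasurable, ← integrableOn_univ,
    ← Set.Iic_union_Ioi (a := (0 : ℝ))]
  refine IntegrableOn.union ?_ ?_
  · have h : IntegrableOn (fun x => a ^ 2 * Real.exp (2 * κ * x)) (Set.Iic 0) :=
      (integrableOn_exp_mul_Iic (by positivity) 0).const_mul _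
    refine h.congr_fun (fun x hx => ?_) measurableSet_Iic
    have hx' : ¬ 0 < x := not_lt.2 hx
    simp only [twoSidedExpFun, if_neg hx', Complex.norm_real, Real.norm_eq_abs, sq_abs]
    rw [mul_pow, ← Real.exp_nat_mul]
    congr 2; ring_nf
  · have h : IntegrableOn (fun x => b ^ 2 * Real.exp (-(2 * κ) * x)) (Set.Ioi 0) :=
      (integrableOn_exp_mul_Ioi (by linarith) 0).const_mul _
    refine h.congr_fun (fun x hx => ?_) measurableSet_Ioi
    have hx' : 0 < x := hx
    simp only [twoSidedExpFun, if_pos hx', Complex.norm_real, Real.norm_eq_abs, sq_abs]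
    rw [mul_pow, ← Real.exp_nat_mul]
    congr 2; ring_nf

/-- The element of `L²(ℝ)` given by `twoSidedExpFun`; it is zero unless `κ > 0`. -/
def twoSidedExp (κ a b : ℝ) : L2 :=
  if h : 0 < κ then (memLp_twoSidedExpFun h a b).toLp _ else 0

theorem coeFn_twoSidedExp {κ : ℝ} (hκ : 0 < κ) (a b : ℝ) :
    twoSidedExp κ a b =ᵐ[volume] twoSidedExpFun κ a b := by
  rw [twoSidedExp, dif_pos hκ]
  exact MemLp.coeFn_toLp _

theorem twoSidedExp_ae_right {κ : ℝ} (hκ : 0 < κ) (a b : ℝ) : ∀ᵐ x : ℝ, x ∈ Set.Ioi (0 : ℝ) →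
    twoSidedExp κ a b x = ((b * Real.exp (-κ * x) : ℝ) : ℂ) := by
  filter_upwards [coeFn_twoSidedExp hκ a b] with x hx h0
  rw [hx, twoSidedExpFun, if_pos (Set.mem_Ioi.1 h0)]

theorem twoSidedExp_ae_left {κ : ℝ} (hκ : 0 < κ) (a b : ℝ) : ∀ᵐ x : ℝ, x ∈ Set.Iio (0 : ℝ) →
    twoSidedExp κ a b x = ((a * Real.exp (κ * x) : ℝ) : ℂ) := by
  filter_upwards [coeFn_twoSidedExp hκ a b] with x hx h0
  rw [hx, twoSidedExpFun, if_neg (not_lt.2 (le_of_lt h0))]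

theorem hasRightValue_twoSidedExp {κ : ℝ} (hκ : 0 < κ) (a b : ℝ) :
    HasRightValue (twoSidedExp κ a b) b := by
  simpa using hasRightValue_of_ae_eq
    (F := fun x => ((b * Real.exp (-κ * x) : ℝ) : ℂ)) (by fun_prop) (twoSidedExp_ae_right hκ a b)

theorem hasLeftValue_twoSidedExp {κ : ℝ} (hκ : 0 < κ) (a b : ℝ) :
    HasLeftValue (twoSidedExp κ a b) a := by
  simpa using hasLeftValue_of_ae_eq
    (F := fun x => ((a * Real.exp (κ * x) : ℝ) : ℂ)) (by fun_prop) (twoSidedExp_ae_left hκ a b)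

theorem isWeakDeriv_twoSidedExp {κ : ℝ} (hκ : 0 < κ) (a b : ℝ) :
    IsWeakDeriv (twoSidedExp κ a b) (twoSidedExp κ (κ * a) (-(κ * b))) := by
  have hP (c k : ℝ) : IsPrimitive (fun x => ((c * Real.exp (k * x) : ℝ) : ℂ))
      (fun x => ((k * c * Real.exp (k * x) : ℝ) : ℂ)) := by
    refine isPrimitive_of_hasDerivAt (fun x => ?_) (by fun_prop)
    have h : HasDerivAt (fun x : ℝ => c * Real.exp (k * x)) (k * c * Real.exp (k * x)) x := by
      convert! (((hasDerivAt_id x).const_mul k).exp.const_mul c) using 1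
      simp; ring
    exact h.ofReal_comp
  refine isWeakDeriv_of_isPrimitive (hP b (-κ)) (hP a κ) ?_ ?_
  · filter_upwards [twoSidedExp_ae_right hκ a b, twoSidedExp_ae_right hκ (κ * a) (-(κ * b))]
      with x h1 h2 h0
    rw [h1 h0, h2 h0]
    exact ⟨rfl, by push_cast; ring⟩
  · filter_upwards [twoSidedExp_ae_left hκ a b, twoSidedExp_ae_left hκ (κ * a) (-(κ * b))]
      with x h1 h2 h0
    rw [h1 h0, h2 h0]
    exact ⟨rfl, rfl⟩

theorem smul_twoSidedExp {κ : ℝ} (hκ : 0 < κ) (c a b : ℝ) :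
    (c : ℂ) • twoSidedExp κ a b = twoSidedExp κ (c * a) (c * b) := by
  apply Lp.ext
  filter_upwards [Lp.coeFn_smul (c : ℂ) (twoSidedExp κ a b), coeFn_twoSidedExp hκ a b,
    coeFn_twoSidedExp hκ (c * a) (c * b)] with x h1 h2 h3
  rw [h1, h3, Pi.smul_apply, h2]
  simp only [twoSidedExpFun]
  split_ifs <;> simp <;> ring

/-- The value at `-0` is a bounded functional of the pair `(f, f')`. -/
theorem IsWeakDeriv.hasLeftValue {f f' : L2} (h : IsWeakDeriv f f') {κ : ℝ} (hκ : 0 < κ) :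
    HasLeftValue f (inner ℂ (twoSidedExp κ 1 0) ((κ : ℂ) • f + f')) := by
  obtain ⟨l, hl⟩ := h.exists_hasLeftValue
  obtain ⟨r, hr⟩ := h.exists_hasRightValue
  have := h.green (isWeakDeriv_twoSidedExp hκ 1 0) hl hr (hasLeftValue_twoSidedExp hκ 1 0)
    (hasRightValue_twoSidedExp hκ 1 0)
  have e : twoSidedExp κ (κ * 1) (-(κ * 0)) = (κ : ℂ) • twoSidedExp κ 1 0 := by
    rw [smul_twoSidedExp hκ]; simp
  rw [e, inner_smul_left] at this
  rw [inner_add_right, inner_smul_right]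
  convert hl using 1
  simpa using this

/-- The value at `+0` is a bounded functional of the pair `(f, f')`. -/
theorem IsWeakDeriv.hasRightValue {f f' : L2} (h : IsWeakDeriv f f') {κ : ℝ} (hκ : 0 < κ) :
    HasRightValue f (inner ℂ (twoSidedExp κ 0 1) ((κ : ℂ) • f - f')) := by
  obtain ⟨l, hl⟩ := h.exists_hasLeftValue
  obtain ⟨r, hr⟩ := h.exists_hasRightValue
  have := h.green (isWeakDeriv_twoSidedExp hκ 0 1) hl hr (hasLeftValue_twoSidedExp hκ 0 1)
    (hasRightValue_twoSidedExp hκ 0 1)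
  have e : twoSidedExp κ (κ * 0) (-(κ * 1)) = ((-κ : ℝ) : ℂ) • twoSidedExp κ 0 1 := by
    rw [smul_twoSidedExp hκ]; simp
  rw [e, inner_smul_left] at this
  rw [inner_sub_right, inner_smul_right]
  convert hr using 1
  simp at this
  linear_combination -this

/-- The norm of a one-sided exponential, obtained by evaluating its trace at `-0`. -/
theorem norm_sq_twoSidedExp {κ : ℝ} (hκ : 0 < κ) : 2 * κ * ‖twoSidedExp κ 1 0‖ ^ 2 = 1 := by
  have h := (hasLeftValue_twoSidedExp hκ 1 0).unique
    ((isWeakDeriv_twoSidedExp hκ 1 0).hasLeftValue hκ)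
  have e : twoSidedExp κ (κ * 1) (-(κ * 0)) = (κ : ℂ) • twoSidedExp κ 1 0 := by
    rw [smul_twoSidedExp hκ]; simp
  rw [e, ← two_smul ℂ, smul_smul, inner_smul_right, inner_self_eq_norm_sq_to_K] at h
  apply Complex.ofReal_injective
  push_cast
  exact h.symm.trans Complex.ofReal_one

/-! ### Multiplication by the potential -/

/-- Multiplication by `W ∈ L^∞(ℝ)` as a bounded operator on `L²(ℝ)`. -/
def potentialOp (W : Lp ℝ ∞ (volume : Measure ℝ)) : L2 →L[ℂ] L2 :=
  LinearMap.mkContinuous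
    { toFun := fun f => W • f
      map_add' := fun f g => Lp.add_smul W f g
      map_smul' := fun c f => by
        apply Lp.ext
        filter_upwards [Lp.coeFn_lpSMul (r := 2) W (c • f), Lp.coeFn_smul c (W • f : L2),
          Lp.coeFn_lpSMul (r := 2) W f, Lp.coeFn_smul c f] with x h1 h2 h3 h4
        simp only [RingHom.id_apply]
        rw [h1, h2, Pi.smul_apply', Pi.smul_apply, h3, h4, Pi.smul_apply, Pi.smul_apply',
          smul_comm] }
    ‖W‖ (fun f => Lp.norm_smul_le W f)

theorem potentialOp_apply (W : Lp ℝ ∞ (volume : Measure ℝ)) (f : L2) :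
    potentialOp W f = W • f := rfl

theorem potentialOp_symm (W : Lp ℝ ∞ (volume : Measure ℝ)) (f g : L2) :
    inner ℂ (potentialOp W f) g = inner ℂ f (potentialOp W g) := by
  rw [L2.inner_def, L2.inner_def, potentialOp_apply, potentialOp_apply]
  refine integral_congr_ae ?_
  filter_upwards [Lp.coeFn_lpSMul (r := 2) W f, Lp.coeFn_lpSMul (r := 2) W g] with x h1 h2
  rw [h1, h2, Pi.smul_apply', Pi.smul_apply', inner_smul_left_eq_smul, inner_smul_right_eq_smul]

theorem inner_potentialOp_self (W : Lp ℝ ∞ (volume : Measure ℝ)) (f : L2) :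
    inner ℂ (potentialOp W f) f = ((∫ x, W x * ‖f x‖ ^ 2 : ℝ) : ℂ) := by
  rw [L2.inner_def, potentialOp_apply, ← integral_complex_ofReal]
  refine integral_congr_ae ?_
  filter_upwards [Lp.coeFn_lpSMul (r := 2) W f] with x h1
  rw [h1, Pi.smul_apply', inner_smul_left_eq_smul, inner_self_eq_norm_sq_to_K]
  simp

theorem re_inner_potentialOp_self_nonneg {W : Lp ℝ ∞ (volume : Measure ℝ)}
    (hW : ∀ᵐ x : ℝ, 0 ≤ W x) (f : L2) : 0 ≤ (inner ℂ (potentialOp W f) f).re := by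
  rw [inner_potentialOp_self, Complex.ofReal_re]
  exact integral_nonneg_of_ae (by filter_upwards [hW] with x hx; positivity)

/-! ### Eigenvalues and the quadratic form -/

theorem isEigenvalue_hamiltonian_iff {θ η : ℝ} {W : Lp ℝ ∞ (volume : Measure ℝ)} {μ : ℂ} :
    IsEigenvalue (hamiltonian θ η W) μ ↔ ∃ φ dφ ddφ : L2, IsDomainTriple θ η φ dφ ddφ ∧ φ ≠ 0 ∧
      -ddφ + potentialOp W φ = μ • φ := by
  constructor
  · rintro ⟨φ, h0, h⟩
    obtain ⟨dφ, ddφ, ht⟩ := φ.2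
    refine ⟨φ, dφ, ddφ, ht, h0, ?_⟩
    rw [← h, ← secondDeriv_eq φ ht]
    rfl
  · rintro ⟨φ, dφ, ddφ, ht, h0, h⟩
    refine ⟨⟨φ, dφ, ddφ, ht⟩, h0, ?_⟩
    rw [← secondDeriv_eq ⟨φ, dφ, ddφ, ht⟩ ht] at h
    exact h

/-- The sesquilinear form of the Hamiltonian: the interface conditions turn the boundary terms of
Green's formula into the rank-one term `ηθ · conj φ(-0) · ψ(-0)`. -/
theorem IsDomainTriple.inner_neg {θ η : ℝ} (hθ : θ ≠ 0) {φ dφ ddφ ψ dψ ddψ : L2}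
    (h : IsDomainTriple θ η φ dφ ddφ) (k : IsDomainTriple θ η ψ dψ ddψ) {l m : ℂ}
    (hl : HasLeftValue φ l) (hm : HasLeftValue ψ m) :
    inner ℂ φ (-ddψ) = inner ℂ dφ dψ + η * θ * ((starRingEnd ℂ) l * m) := by
  obtain ⟨l', r, l1, r1, h1, h2, -, -, h5, -⟩ := h.2.2
  obtain ⟨m', s, m1, s1, k1, -, k3, k4, -, k6⟩ := k.2.2
  obtain rfl := h1.unique hl
  obtain rfl := k1.unique hm
  have hg := k.2.1.green h.1 k3 k4 h1 h2
  rw [inner_neg_right]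
  have hθ' : (θ : ℂ) ≠ 0 := by exact_mod_cast hθ
  rw [h5, k6, map_mul, Complex.conj_ofReal] at hg
  have e : (θ : ℂ) * (starRingEnd ℂ) l' * ((θ : ℂ)⁻¹ * m1 + η * m') =
      (starRingEnd ℂ) l' * m1 + η * θ * ((starRingEnd ℂ) l' * m') := by
    field_simp
  rw [e] at hg
  linear_combination -hg

theorem IsDomainTriple.inner_hamiltonian {θ η : ℝ} (hθ : θ ≠ 0)
    (W : Lp ℝ ∞ (volume : Measure ℝ)) {φ dφ ddφ ψ dψ ddψ : L2}
    (h : IsDomainTriple θ η φ dφ ddφ) (k : IsDomainTriple θ η ψ dψ ddψ) {l m : ℂ}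
    (hl : HasLeftValue φ l) (hm : HasLeftValue ψ m) :
    inner ℂ φ (-ddψ + potentialOp W ψ) =
      inner ℂ dφ dψ + inner ℂ φ (potentialOp W ψ) + η * θ * ((starRingEnd ℂ) l * m) := by
  rw [inner_add_right, h.inner_neg hθ k hl hm]; ring

theorem IsDomainTriple.inner_hamiltonian_symm {θ η : ℝ} (hθ : θ ≠ 0)
    (W : Lp ℝ ∞ (volume : Measure ℝ)) {φ dφ ddφ ψ dψ ddψ : L2}
    (h : IsDomainTriple θ η φ dφ ddφ) (k : IsDomainTriple θ η ψ dψ ddψ) :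
    inner ℂ φ (-ddψ + potentialOp W ψ) = inner ℂ (-ddφ + potentialOp W φ) ψ := by
  obtain ⟨l, hl⟩ := h.1.exists_hasLeftValue
  obtain ⟨m, hm⟩ := k.1.exists_hasLeftValue
  rw [← inner_conj_symm (-ddφ + potentialOp W φ) ψ, h.inner_hamiltonian hθ W k hl hm,
    k.inner_hamiltonian hθ W h hm hl]
  simp only [map_add, map_mul, inner_conj_symm, Complex.conj_conj, Complex.conj_ofReal]
  rw [potentialOp_symm]; ring

/-- On functions vanishing at `-0` the form of the Hamiltonian is non-negative. -/
theorem IsDomainTriple.re_inner_hamiltonian_nonneg {θ η : ℝ} (hθ : θ ≠ 0)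
    {W : Lp ℝ ∞ (volume : Measure ℝ)} (hW : ∀ᵐ x : ℝ, 0 ≤ W x) {φ dφ ddφ : L2}
    (h : IsDomainTriple θ η φ dφ ddφ) (hl : HasLeftValue φ 0) :
    0 ≤ (inner ℂ φ (-ddφ + potentialOp W φ)).re := by
  rw [h.inner_hamiltonian hθ W h hl hl, ← potentialOp_symm]
  have h1 := re_inner_potentialOp_self_nonneg hW φ
  have h2 : 0 ≤ (inner ℂ dφ dφ).re := inner_self_nonneg (𝕜 := ℂ) (x := dφ)
  simp only [map_zero, mul_zero, add_zero, Complex.add_re]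
  linarith

theorem HasLeftValue.add {f g : L2} {a b : ℂ} (hf : HasLeftValue f a) (hg : HasLeftValue g b) :
    HasLeftValue (f + g) (a + b) :=
  (Tendsto.add hf hg).congr' (EventuallyEq.filter_mono (Lp.coeFn_add f g).symm inf_le_right)

theorem HasLeftValue.smul {f : L2} {a : ℂ} (c : ℂ) (hf : HasLeftValue f a) :
    HasLeftValue (c • f) (c * a) :=
  (Tendsto.const_mul c hf).congr' (EventuallyEq.filter_mono (Lp.coeFn_smul c f).symm inf_le_right)

/-- Two different negative eigenvalues would give a two-dimensional space on which the form is
negative definite, and this space would contain a function vanishing at `-0`. -/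
theorem negative_eigenvalue_unique {θ η : ℝ} (hθ : θ ≠ 0)
    {W : Lp ℝ ∞ (volume : Measure ℝ)} (hW : ∀ᵐ x : ℝ, 0 ≤ W x) {E E' : ℝ}
    (hE : E < 0) (hE' : E' < 0) (h : IsEigenvalue (hamiltonian θ η W) (E : ℂ))
    (h' : IsEigenvalue (hamiltonian θ η W) (E' : ℂ)) : E' = E := by
  obtain ⟨φ, dφ, ddφ, h, hφ0, hφ⟩ := isEigenvalue_hamiltonian_iff.1 h
  obtain ⟨ψ, dψ, ddψ, k, hψ0, hψ⟩ := isEigenvalue_hamiltonian_iff.1 h'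
  by_contra hne
  have horth : inner ℂ φ ψ = 0 := by
    have e := h.inner_hamiltonian_symm hθ W k
    rw [hφ, hψ, inner_smul_right, inner_smul_left, Complex.conj_ofReal, ← sub_eq_zero,
      ← sub_mul, mul_eq_zero] at e
    refine e.resolve_left fun h0 => hne ?_
    exact_mod_cast sub_eq_zero.1 h0
  have horth' : inner ℂ ψ φ = 0 := inner_eq_zero_symm.1 horth
  obtain ⟨l, hl⟩ := h.1.exists_hasLeftValue
  obtain ⟨m, hm⟩ := k.1.exists_hasLeftValue
  have hl0 : l ≠ 0 := by
    rintro rfl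
    have e := h.re_inner_hamiltonian_nonneg hθ hW hl
    rw [hφ, inner_smul_right, inner_self_eq_norm_sq_to_K] at e
    have e' : 0 ≤ E * ‖φ‖ ^ 2 := by
      have e2 : (E : ℂ) * (((‖φ‖ : ℝ) : ℂ) ^ 2) = ((E * ‖φ‖ ^ 2 : ℝ) : ℂ) := by push_cast; ring
      have e3 : 0 ≤ ((E : ℂ) * (((‖φ‖ : ℝ) : ℂ) ^ 2)).re := e
      rwa [e2, Complex.ofReal_re] at e3
    have := mul_neg_of_neg_of_pos hE (pow_pos (norm_pos_iff.2 hφ0) 2)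
    linarith
  -- the combination of the two eigenfunctions that vanishes at `-0`
  have hχ := (h.smul m).add (k.smul (-l))
  have hχl : HasLeftValue (m • φ + -l • ψ) 0 := by
    convert (hl.smul m).add (hm.smul (-l)) using 1
    ring
  have e := hχ.re_inner_hamiltonian_nonneg hθ hW hχl
  have eH : -(m • ddφ + -l • ddψ) + potentialOp W (m • φ + -l • ψ) =
      (m * E) • φ + (-l * E') • ψ := by
    rw [map_add, map_smul, map_smul, mul_smul, mul_smul, ← hφ, ← hψ]
    module
  rw [eH] at e
  have e2 : inner ℂ (m • φ + -l • ψ) ((m * E) • φ + (-l * E') • ψ) =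
      ((E * (‖m‖ ^ 2 * ‖φ‖ ^ 2) + E' * (‖l‖ ^ 2 * ‖ψ‖ ^ 2) : ℝ) : ℂ) := by
    simp only [inner_add_left, inner_add_right, inner_smul_left, inner_smul_right, horth, horth',
      inner_self_eq_norm_sq_to_K, map_neg]
    push_cast
    rw [← Complex.conj_mul' m, ← Complex.conj_mul' l]
    simp only [Complex.coe_algebraMap]
    ring
  rw [e2, Complex.ofReal_re] at e
  have p1 : 0 ≤ ‖m‖ ^ 2 * ‖φ‖ ^ 2 := by positivity
  have p2 : 0 < ‖l‖ ^ 2 * ‖ψ‖ ^ 2 :=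
    mul_pos (pow_pos (norm_pos_iff.2 hl0) 2) (pow_pos (norm_pos_iff.2 hψ0) 2)
  nlinarith [mul_nonneg (neg_nonneg.2 hE.le) p1, mul_pos (neg_pos.2 hE') p2]

/-! ### A rank-one perturbation problem in Hilbert space -/

/-- Let `A + κ² B` be symmetric and coercive for `κ > 0`. Then `⟪p, (A + κ² B)⁻¹ p⟫` is a continuous
function of `κ`; the two bounds make it at least `1 / c` at `κ₁` and at most `1 / c` at `c`. -/
theorem exists_solution_inner_eq_inv {H : Type*} [NormedAddCommGroup H] [InnerProductSpace ℂ H]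
    [CompleteSpace H] (A B : H →L[ℂ] H) (p : H) {c κ₁ : ℝ} (hc : 0 < c) (hκ₁ : 0 < κ₁)
    (hκ₁c : κ₁ ≤ c)
    (hA : ∀ u v, inner ℂ (A u) v = inner ℂ u (A v)) (hB : ∀ u v, inner ℂ (B u) v = inner ℂ u (B v))
    (hcoer : ∀ κ : ℝ, 0 < κ → ∃ δ : ℝ, 0 < δ ∧ ∀ u,
      δ * ‖u‖ ^ 2 ≤ (inner ℂ ((A + ((κ ^ 2 : ℝ) : ℂ) • B) u) u).re)
    (hupper : ∀ u, ‖inner ℂ p u‖ ^ 2 ≤ (inner ℂ ((A + ((c ^ 2 : ℝ) : ℂ) • B) u) u).re / c)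
    {v : H} (hv : inner ℂ p v = 1)
    (hlower : (inner ℂ ((A + ((κ₁ ^ 2 : ℝ) : ℂ) • B) v) v).re ≤ c) :
    ∃ κ : ℝ, 0 < κ ∧ ∃ u, (A + ((κ ^ 2 : ℝ) : ℂ) • B) u = p ∧ inner ℂ p u = ((1 / c : ℝ) : ℂ) := by
  set T : ℝ → (H →L[ℂ] H) := fun κ => A + ((κ ^ 2 : ℝ) : ℂ) • B with hT
  have hTsymm (κ : ℝ) (u v : H) : inner ℂ (T κ u) v = inner ℂ u (T κ v) := by
    simp only [hT, add_apply, smul_apply, inner_add_left,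
      inner_add_right, inner_smul_left, inner_smul_right, hA, hB, Complex.conj_ofReal]
  have hTcont : Continuous T := by
    have : Continuous fun κ : ℝ => ((κ ^ 2 : ℝ) : ℂ) := by fun_prop
    exact continuous_const.add (this.smul continuous_const)
  have hunit (κ : ℝ) (hκ : 0 < κ) : IsUnit (T κ) := by
    obtain ⟨δ, hδ, h⟩ := hcoer κ hκ
    refine ContinuousLinearMap.isUnit_of_forall_le_norm_inner_map (T κ) (c := ⟨δ, hδ.le⟩) hδ
      fun x => ?_
    calc ‖x‖ ^ 2 * δ = δ * ‖x‖ ^ 2 := mul_comm _ _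
      _ ≤ _ := h x
      _ ≤ _ := Complex.re_le_norm _
  set g : ℝ → H := fun κ => Ring.inverse (T κ) p with hg
  have hTg (κ : ℝ) (hκ : 0 < κ) : T κ (g κ) = p := by
    have := Ring.mul_inverse_cancel _ (hunit κ hκ)
    exact congrArg (fun S : H →L[ℂ] H => S p) this
  set G : ℝ → ℝ := fun κ => (inner ℂ p (g κ)).re with hG
  have hGcont : ContinuousOn G (Set.Icc κ₁ c) := by
    intro κ hκ
    have hu := hunit κ (hκ₁.trans_le hκ.1)
    have h1 : ContinuousAt Ring.inverse (T κ) := by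
      obtain ⟨x, hx⟩ := hu
      rw [← hx]
      exact NormedRing.inverse_continuousAt x
    have h2 : ContinuousAt (fun κ => Ring.inverse (T κ)) κ :=
      ContinuousAt.comp (f := T) h1 hTcont.continuousAt
    have h3 : ContinuousAt g κ := h2.clm_apply continuousAt_const
    exact (Complex.continuous_re.continuousAt.comp
      (continuousAt_const.inner h3)).continuousWithinAt
  have hGreal (κ : ℝ) (hκ : 0 < κ) : inner ℂ p (g κ) = (G κ : ℂ) := by
    have h1 : (starRingEnd ℂ) (inner ℂ p (g κ)) = inner ℂ p (g κ) := by
      conv_rhs => rw [← hTg κ hκ, hTsymm, hTg κ hκ]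
      rw [inner_conj_symm]
    exact (Complex.conj_eq_iff_re.1 h1).symm
  have hGc : G c ≤ 1 / c := by
    -- the upper bound at `g`, where the form equals `G`, reads `G² ≤ G / c`
    have h1 := hupper (g c)
    change _ ≤ (inner ℂ (T c (g c)) (g c)).re / c at h1
    rw [hTg c hc, hGreal c hc, Complex.ofReal_re, Complex.norm_real, Real.norm_eq_abs, sq_abs] at h1
    rw [le_div_iff₀ hc] at h1 ⊢
    by_contra hlt
    push Not at hlt
    have hpos : 0 < G c := by
      by_contra hn
      nlinarith
    nlinarith
  have hGκ₁ : 1 / c ≤ G κ₁ := by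
    -- the form is non-negative at `c g - v`, where it equals `c² G - 2c + a(v, v)`
    obtain ⟨δ, hδ, h⟩ := hcoer κ₁ hκ₁
    have h0 := (by positivity : 0 ≤ δ * ‖(c : ℂ) • g κ₁ - v‖ ^ 2).trans (h ((c : ℂ) • g κ₁ - v))
    change 0 ≤ (inner ℂ (T κ₁ ((c : ℂ) • g κ₁ - v)) ((c : ℂ) • g κ₁ - v)).re at h0
    have hv' : inner ℂ v p = 1 := by rw [← inner_conj_symm, hv, map_one]
    have e : inner ℂ (T κ₁ ((c : ℂ) • g κ₁ - v)) ((c : ℂ) • g κ₁ - v) =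
        ((c ^ 2 * G κ₁ - 2 * c : ℝ) : ℂ) + inner ℂ (T κ₁ v) v := by
      simp only [map_sub, map_smul, inner_sub_left, inner_sub_right, inner_smul_left,
        inner_smul_right, Complex.conj_ofReal, hTg κ₁ hκ₁, hv, hGreal κ₁ hκ₁,
        hTsymm κ₁ v (g κ₁), hv']
      push_cast
      ring
    rw [e, Complex.add_re, Complex.ofReal_re] at h0
    rw [div_le_iff₀ hc]
    have : (inner ℂ (T κ₁ v) v).re ≤ c := hlower
    by_contra hlt
    push Not at hlt
    nlinarith
  obtain ⟨κ, hκ, hκG⟩ := intermediate_value_Icc' hκ₁c hGcont ⟨hGc, hGκ₁⟩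
  have hκ0 := hκ₁.trans_le hκ.1
  exact ⟨κ, hκ0, g κ, hTg κ hκ0, by rw [hGreal κ hκ0, hκG]⟩

/-! ### The form domain -/

/-- A continuous compactly supported real function as an element of `L²(ℝ)`; it is zero for all
other functions. -/
def testL2 (ζ : ℝ → ℝ) : L2 :=
  open Classical in
  if h : Continuous ζ ∧ HasCompactSupport ζ then
    ((Complex.continuous_ofReal.comp h.1).memLp_of_hasCompactSupport
      (h.2.comp_left Complex.ofReal_zero)).toLp (fun x => (ζ x : ℂ))
  else 0

theorem coeFn_testL2 {ζ : ℝ → ℝ} (h1 : Continuous ζ) (h2 : HasCompactSupport ζ) :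
    testL2 ζ =ᵐ[volume] fun x => (ζ x : ℂ) := by
  rw [testL2, dif_pos ⟨h1, h2⟩]
  exact MemLp.coeFn_toLp _

theorem inner_testL2 {ζ : ℝ → ℝ} (h1 : Continuous ζ) (h2 : HasCompactSupport ζ) (f : L2) :
    inner ℂ (testL2 ζ) f = ∫ x, ζ x • f x := by
  rw [L2.inner_def]
  refine integral_congr_ae ?_
  filter_upwards [coeFn_testL2 h1 h2] with x hx
  rw [hx, RCLike.inner_apply', Complex.conj_ofReal, Complex.real_smul]

theorem isWeakDeriv_testL2 {ζ : ℝ → ℝ} (h1 : ContDiff ℝ ∞ ζ) (h2 : HasCompactSupport ζ) :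
    IsWeakDeriv (testL2 ζ) (testL2 (deriv ζ)) := by
  have hc : Continuous (deriv ζ) := h1.continuous_deriv (by simp)
  have hζ : IsPrimitive (fun x => (ζ x : ℂ)) (fun x => ((deriv ζ x : ℝ) : ℂ)) :=
    isPrimitive_of_hasDerivAt
      (fun x => (h1.differentiable (by simp) x).hasDerivAt.ofReal_comp)
      (Complex.continuous_ofReal.comp hc)
  refine isWeakDeriv_of_isPrimitive hζ hζ ?_ ?_ <;>
  · filter_upwards [coeFn_testL2 h1.continuous h2, coeFn_testL2 hc h2.deriv] with x e1 e2 _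
    exact ⟨e1, e2⟩

theorem hasLeftValue_testL2 {ζ : ℝ → ℝ} (h1 : Continuous ζ) (h2 : HasCompactSupport ζ) :
    HasLeftValue (testL2 ζ) (ζ 0 : ℂ) :=
  hasLeftValue_of_ae_eq (F := fun x => (ζ x : ℂ)) (Complex.continuous_ofReal.comp h1) (by
    filter_upwards [coeFn_testL2 h1 h2] with x hx _ using hx)

theorem hasRightValue_testL2 {ζ : ℝ → ℝ} (h1 : Continuous ζ) (h2 : HasCompactSupport ζ) :
    HasRightValue (testL2 ζ) (ζ 0 : ℂ) :=
  hasRightValue_of_ae_eq (F := fun x => (ζ x : ℂ)) (Complex.continuous_ofReal.comp h1) (by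
    filter_upwards [coeFn_testL2 h1 h2] with x hx _ using hx)

theorem isClosed_isWeakDeriv : IsClosed {u : WithLp 2 (L2 × L2) | IsWeakDeriv u.fst u.snd} := by
  simp only [IsWeakDeriv, Set.ofPred_forall]
  refine isClosed_iInter fun ζ => isClosed_iInter fun h1 => isClosed_iInter fun h2 =>
    isClosed_iInter fun _ => ?_
  simp_rw [← inner_testL2 (h1.continuous_deriv (by simp)) h2.deriv,
    ← inner_testL2 h1.continuous h2]
  refine isClosed_eq (continuous_const.inner ?_) (continuous_const.inner ?_).neg
  · exact (WithLp.fstL 2 ℂ L2 L2).continuous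
  · exact (WithLp.sndL 2 ℂ L2 L2).continuous

/-- The bounded functional on pairs `(f, f')` that gives the value `f(-0)`. -/
def leftTrace (f f' : L2) : ℂ := inner ℂ (twoSidedExp 1 1 0) (f + f')

/-- The bounded functional on pairs `(f, f')` that gives the value `f(+0)`. -/
def rightTrace (f f' : L2) : ℂ := inner ℂ (twoSidedExp 1 0 1) (f - f')

theorem IsWeakDeriv.hasLeftValue_leftTrace {f f' : L2} (h : IsWeakDeriv f f') :
    HasLeftValue f (leftTrace f f') := by
  simpa [leftTrace] using h.hasLeftValue one_pos

theorem IsWeakDeriv.hasRightValue_rightTrace {f f' : L2} (h : IsWeakDeriv f f') :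
    HasRightValue f (rightTrace f f') := by
  simpa [rightTrace] using h.hasRightValue one_pos

/-- The form domain of the Hamiltonian: the pairs `(f, f')` with `f ∈ W¹₂(ℝ ∖ {0})` and
`f(+0) = θ f(-0)`, as a subspace of `L²(ℝ) × L²(ℝ)`. The condition on the derivatives is not
imposed; it comes out as a natural boundary condition. -/
def formDomain (θ : ℝ) : Submodule ℂ (WithLp 2 (L2 × L2)) where
  carrier := {u | IsWeakDeriv u.fst u.snd ∧ rightTrace u.fst u.snd = θ * leftTrace u.fst u.snd}
  add_mem' := by
    rintro u v ⟨h1, h2⟩ ⟨k1, k2⟩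
    refine ⟨h1.add k1, ?_⟩
    simp only [leftTrace, rightTrace, WithLp.add_fst, WithLp.add_snd, inner_add_right,
      inner_sub_right] at h2 k2 ⊢
    linear_combination h2 + k2
  zero_mem' := ⟨isWeakDeriv_zero, by simp [leftTrace, rightTrace]⟩
  smul_mem' := by
    rintro c u ⟨h1, h2⟩
    refine ⟨h1.smul c, ?_⟩
    simp only [leftTrace, rightTrace, WithLp.smul_fst, WithLp.smul_snd, inner_add_right,
      inner_sub_right, inner_smul_right] at h2 ⊢
    linear_combination c * h2

theorem mem_formDomain {θ : ℝ} {f f' : L2} (h : IsWeakDeriv f f') {l r : ℂ}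
    (hl : HasLeftValue f l) (hr : HasRightValue f r) (hlr : r = θ * l) :
    WithLp.toLp 2 (f, f') ∈ formDomain θ := by
  refine ⟨h, ?_⟩
  obtain rfl := hl.unique h.hasLeftValue_leftTrace
  obtain rfl := hr.unique h.hasRightValue_rightTrace
  exact hlr

theorem isClosed_formDomain (θ : ℝ) : IsClosed (formDomain θ : Set (WithLp 2 (L2 × L2))) := by
  refine isClosed_isWeakDeriv.inter (isClosed_eq ?_ (continuous_const.mul ?_))
  · exact continuous_const.inner
      ((WithLp.fstL 2 ℂ L2 L2).continuous.sub (WithLp.sndL 2 ℂ L2 L2).continuous)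
  · exact continuous_const.inner
      ((WithLp.fstL 2 ℂ L2 L2).continuous.add (WithLp.sndL 2 ℂ L2 L2).continuous)

instance (θ : ℝ) : CompleteSpace (formDomain θ) :=
  (isClosed_formDomain θ).completeSpace_coe

/-- The bounded map `(f, f') ↦ f` on the form domain. -/
def formFst (θ : ℝ) : formDomain θ →L[ℂ] L2 :=
  (WithLp.fstL 2 ℂ L2 L2).comp (formDomain θ).subtypeL

/-- The bounded map `(f, f') ↦ f'` on the form domain. -/
def formSnd (θ : ℝ) : formDomain θ →L[ℂ] L2 :=
  (WithLp.sndL 2 ℂ L2 L2).comp (formDomain θ).subtypeL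

theorem isWeakDeriv_formDomain {θ : ℝ} (u : formDomain θ) :
    IsWeakDeriv (formFst θ u) (formSnd θ u) := u.2.1

theorem norm_sq_formDomain {θ : ℝ} (u : formDomain θ) :
    ‖u‖ ^ 2 = ‖formFst θ u‖ ^ 2 + ‖formSnd θ u‖ ^ 2 :=
  WithLp.prod_norm_sq_eq_of_L2 (u : WithLp 2 (L2 × L2))

/-- The bounded operator on the form domain given by the form `⟪f', g'⟫ + ⟪W f, g⟫`. -/
def energyOp (θ : ℝ) (W : Lp ℝ ∞ (volume : Measure ℝ)) : formDomain θ →L[ℂ] formDomain θ :=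
  (formFst θ).adjoint.comp ((potentialOp W).comp (formFst θ)) +
    (formSnd θ).adjoint.comp (formSnd θ)

/-- The bounded operator on the form domain given by the form `⟪f, g⟫`. -/
def massOp (θ : ℝ) : formDomain θ →L[ℂ] formDomain θ :=
  (formFst θ).adjoint.comp (formFst θ)

/-- The Riesz representative of the functional `f ↦ f(-0)` on the form domain. -/
def traceVec (θ : ℝ) : formDomain θ :=
  (formFst θ).adjoint (twoSidedExp 1 1 0) + (formSnd θ).adjoint (twoSidedExp 1 1 0)

theorem inner_traceVec {θ : ℝ} (u : formDomain θ) :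
    inner ℂ (traceVec θ) u = leftTrace (formFst θ u) (formSnd θ u) := by
  rw [traceVec, inner_add_left, ContinuousLinearMap.adjoint_inner_left,
    ContinuousLinearMap.adjoint_inner_left, leftTrace, inner_add_right]

theorem inner_energyOp {θ : ℝ} (W : Lp ℝ ∞ (volume : Measure ℝ)) (u v : formDomain θ) :
    inner ℂ (energyOp θ W u) v =
      inner ℂ (potentialOp W (formFst θ u)) (formFst θ v) +
        inner ℂ (formSnd θ u) (formSnd θ v) := by
  simp [energyOp, ContinuousLinearMap.adjoint_inner_left]

theorem inner_massOp {θ : ℝ} (u v : formDomain θ) :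
    inner ℂ (massOp θ u) v = inner ℂ (formFst θ u) (formFst θ v) := by
  simp [massOp, ContinuousLinearMap.adjoint_inner_left]

theorem inner_form {θ : ℝ} (W : Lp ℝ ∞ (volume : Measure ℝ)) (κ : ℝ) (u v : formDomain θ) :
    inner ℂ ((energyOp θ W + ((κ ^ 2 : ℝ) : ℂ) • massOp θ) u) v =
      inner ℂ (potentialOp W (formFst θ u)) (formFst θ v) +
        inner ℂ (formSnd θ u) (formSnd θ v) +
          ((κ ^ 2 : ℝ) : ℂ) * inner ℂ (formFst θ u) (formFst θ v) := by
  rw [add_apply, smul_apply, inner_add_left, inner_smul_left, inner_energyOp, inner_massOp,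
    Complex.conj_ofReal]

theorem re_inner_form_self {θ : ℝ} (W : Lp ℝ ∞ (volume : Measure ℝ)) (κ : ℝ) (u : formDomain θ) :
    (inner ℂ ((energyOp θ W + ((κ ^ 2 : ℝ) : ℂ) • massOp θ) u) u).re =
      (inner ℂ (potentialOp W (formFst θ u)) (formFst θ u)).re +
        ‖formSnd θ u‖ ^ 2 + κ ^ 2 * ‖formFst θ u‖ ^ 2 := by
  rw [inner_form, Complex.add_re, Complex.add_re, Complex.re_ofReal_mul]
  congr 1
  · congr 1
    exact (norm_sq_eq_re_inner (𝕜 := ℂ) _).symm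
  · congr 1
    exact (norm_sq_eq_re_inner (𝕜 := ℂ) _).symm

/-- A solution of the form equation `a(u, v) = conj u₀ · v(-0)` is an eigenfunction: testing away
from the origin gives the differential equation, and the boundary term in Green's formula gives
the jump condition on the derivative. -/
theorem isEigenvalue_of_form_eq {θ η : ℝ} (hθ : θ ≠ 0) (hη : η ≠ 0)
    {W : Lp ℝ ∞ (volume : Measure ℝ)} {κ : ℝ} {u : formDomain θ}
    (h : (energyOp θ W + ((κ ^ 2 : ℝ) : ℂ) • massOp θ) u = traceVec θ)
    (hu : inner ℂ (traceVec θ) u = ((1 / (-(η * θ)) : ℝ) : ℂ)) :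
    IsEigenvalue (hamiltonian θ η W) ((-κ ^ 2 : ℝ) : ℂ) := by
  set f := formFst θ u
  set f' := formSnd θ u
  set f'' : L2 := potentialOp W f + ((κ ^ 2 : ℝ) : ℂ) • f with hf''
  have hf : IsWeakDeriv f f' := isWeakDeriv_formDomain u
  have key (g g' : L2) (hg : IsWeakDeriv g g') {l r : ℂ} (hl : HasLeftValue g l)
      (hr : HasRightValue g r) (hlr : r = θ * l) : inner ℂ f'' g + inner ℂ f' g' = l := by
    have hmem := mem_formDomain hg hl hr hlr
    have e := inner_form W κ u ⟨_, hmem⟩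
    rw [h, inner_traceVec] at e
    have e1 : l = leftTrace g g' := hl.unique hg.hasLeftValue_leftTrace
    rw [e1]
    refine Eq.trans ?_ e.symm
    rw [hf'', inner_add_left, inner_smul_left, Complex.conj_ofReal]
    change _ = inner ℂ (potentialOp W f) g + inner ℂ f' g' + ((κ ^ 2 : ℝ) : ℂ) * inner ℂ f g
    ring
  have hf' : IsWeakDeriv f' f'' := by
    intro ζ h1 h2 h3
    have hc : Continuous (deriv ζ) := h1.continuous_deriv (by simp)
    have hζ0 : ζ 0 = 0 := image_eq_zero_of_notMem_tsupport fun h => h3 h rfl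
    have e := key _ _ (isWeakDeriv_testL2 h1 h2) (hasLeftValue_testL2 h1.continuous h2)
      (hasRightValue_testL2 h1.continuous h2) (by simp [hζ0])
    rw [← inner_testL2 hc h2.deriv, ← inner_testL2 h1.continuous h2,
      ← inner_conj_symm, ← inner_conj_symm (testL2 ζ), ← map_neg]
    congr 1
    rw [hζ0, Complex.ofReal_zero] at e
    linear_combination e
  have hl := hf.hasLeftValue_leftTrace
  have hr := hf.hasRightValue_rightTrace
  have hlr : rightTrace f f' = θ * leftTrace f f' := u.2.2
  have hl0 : leftTrace f f' = ((1 / (-(η * θ)) : ℝ) : ℂ) := by rw [← hu, inner_traceVec]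
  obtain ⟨l', hl'⟩ := hf'.exists_hasLeftValue
  obtain ⟨r', hr'⟩ := hf'.exists_hasRightValue
  -- any element of the form domain with value `1` at `-0` detects the jump of the derivative
  have hw := isWeakDeriv_twoSidedExp one_pos 1 θ
  have hwl := hasLeftValue_twoSidedExp one_pos 1 θ
  have hwr := hasRightValue_twoSidedExp one_pos 1 θ
  have hjump := hw.green hf' hwl hwr hl' hr'
  rw [key _ _ hw hwl hwr (by simp)] at hjump
  have hjump' := congrArg (starRingEnd ℂ) hjump
  simp only [map_sub, map_mul, Complex.conj_conj, Complex.conj_ofReal] at hjump'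
  have hθ' : (θ : ℂ) ≠ 0 := by exact_mod_cast hθ
  have hη' : (η : ℂ) ≠ 0 := by exact_mod_cast hη
  refine isEigenvalue_hamiltonian_iff.2 ⟨f, f', f'', ⟨hf, hf', _, _, l', r', hl, hr, hl', hr',
    hlr, ?_⟩, ?_, ?_⟩
  · rw [hl0]
    push_cast at hjump' ⊢
    field_simp
    linear_combination hjump'
  · intro h0
    rw [hl0, h0] at hl
    have h2 : HasLeftValue 0 0 := by simpa using hl.smul 0
    have h3 := hl.unique h2
    have : (1 / (-(η * θ)) : ℝ) = 0 := by exact_mod_cast h3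
    rw [one_div, inv_eq_zero, neg_eq_zero] at this
    exact (mul_ne_zero hη hθ) this
  · rw [hf'']
    push_cast
    module

/-! ### The trial function -/

theorem isWeakDeriv_isWeakDeriv_twoSidedExp {κ : ℝ} (hκ : 0 < κ) (a b : ℝ) :
    IsWeakDeriv (twoSidedExp κ (κ * a) (-(κ * b))) (((κ ^ 2 : ℝ) : ℂ) • twoSidedExp κ a b) := by
  convert isWeakDeriv_twoSidedExp hκ (κ * a) (-(κ * b)) using 1
  rw [smul_twoSidedExp hκ]
  congr 1 <;> ring

/-- The energy of the trial function without potential is the boundary term of Green's formula. -/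
theorem energy_twoSidedExp {κ : ℝ} (hκ : 0 < κ) (θ : ℝ) :
    ‖twoSidedExp κ (κ * 1) (-(κ * θ))‖ ^ 2 + κ ^ 2 * ‖twoSidedExp κ 1 θ‖ ^ 2 =
      κ * (1 + θ ^ 2) := by
  have h := (isWeakDeriv_isWeakDeriv_twoSidedExp hκ 1 θ).green (isWeakDeriv_twoSidedExp hκ 1 θ)
    (hasLeftValue_twoSidedExp hκ _ _) (hasRightValue_twoSidedExp hκ _ _)
    (hasLeftValue_twoSidedExp hκ _ _) (hasRightValue_twoSidedExp hκ _ _)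
  rw [inner_smul_right, inner_self_eq_norm_sq_to_K, inner_self_eq_norm_sq_to_K,
    Complex.conj_ofReal, Complex.conj_ofReal] at h
  apply Complex.ofReal_injective
  push_cast at h ⊢
  refine h.trans ?_
  ring

theorem integrable_of_compact_support {W : Lp ℝ ∞ (volume : Measure ℝ)}
    (hW : ∃ K : Set ℝ, IsCompact K ∧ ∀ᵐ x : ℝ, x ∉ K → W x = 0) : Integrable W volume := by
  obtain ⟨K, hK, h⟩ := hW
  have h1 : IntegrableOn W K volume :=
    ((Lp.memLp W).locallyIntegrable (by simp)).integrableOn_isCompact hK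
  exact h1.integrable_of_ae_notMem_eq_zero h

theorem re_inner_potentialOp_twoSidedExp_le {W : Lp ℝ ∞ (volume : Measure ℝ)}
    (hW : ∀ᵐ x : ℝ, 0 ≤ W x) (hWi : Integrable W volume) {κ : ℝ} (hκ : 0 < κ) (θ : ℝ) :
    (inner ℂ (potentialOp W (twoSidedExp κ 1 θ)) (twoSidedExp κ 1 θ)).re ≤
      ∫ x in Set.Ioi (0 : ℝ), (W (-x) + θ ^ 2 * W x) := by
  rw [inner_potentialOp_self, Complex.ofReal_re,
    integral_add hWi.comp_neg.integrableOn (hWi.integrableOn.const_mul _), integral_const_mul,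
    integral_comp_neg_Ioi, neg_zero, ← integral_const_mul]
  have i2 : IntegrableOn (fun x => θ ^ 2 * W x) (Set.Ioi 0) volume := hWi.integrableOn.const_mul _
  have b1 : ∀ᵐ x : ℝ, x ∈ Set.Ioi (0 : ℝ) → W x * ‖twoSidedExp κ 1 θ x‖ ^ 2 ≤ θ ^ 2 * W x := by
    filter_upwards [hW, twoSidedExp_ae_right hκ 1 θ] with x h0 hx hx0
    rw [hx hx0, Complex.norm_real, Real.norm_eq_abs, sq_abs, mul_pow, mul_comm]
    have hle : Real.exp (-κ * x) ≤ 1 := Real.exp_le_one_iff.2 (by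
      have := Set.mem_Ioi.1 hx0
      nlinarith)
    exact mul_le_mul_of_nonneg_right
      (mul_le_of_le_one_right (sq_nonneg θ) (pow_le_one₀ (Real.exp_pos _).le hle)) h0
  have b2 : ∀ᵐ x : ℝ, x ∈ Set.Iio (0 : ℝ) → W x * ‖twoSidedExp κ 1 θ x‖ ^ 2 ≤ W x := by
    filter_upwards [hW, twoSidedExp_ae_left hκ 1 θ] with x h0 hx hx0
    rw [hx hx0, Complex.norm_real, Real.norm_eq_abs, sq_abs, one_mul]
    have hle : Real.exp (κ * x) ≤ 1 := Real.exp_le_one_iff.2 (by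
      have := Set.mem_Iio.1 hx0
      nlinarith)
    exact mul_le_of_le_one_right h0 (pow_le_one₀ (Real.exp_pos _).le hle)
  have c : ∀ᵐ x : ℝ, 0 ≤ W x * ‖twoSidedExp κ 1 θ x‖ ^ 2 := by
    filter_upwards [hW] with x hx
    positivity
  have m : AEStronglyMeasurable (fun x => W x * ‖twoSidedExp κ 1 θ x‖ ^ 2) volume :=
    (Lp.aestronglyMeasurable W).mul ((Lp.aestronglyMeasurable _).norm.pow 2)
  have j1 : IntegrableOn (fun x => W x * ‖twoSidedExp κ 1 θ x‖ ^ 2) (Set.Ioi 0) volume := by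
    refine i2.mono' m.restrict ?_
    filter_upwards [(ae_restrict_iff' measurableSet_Ioi).2 b1, ae_restrict_of_ae c] with x h1 h2
    rwa [Real.norm_of_nonneg h2]
  have j2 : IntegrableOn (fun x => W x * ‖twoSidedExp κ 1 θ x‖ ^ 2) (Set.Iio 0) volume := by
    refine hWi.integrableOn.mono' m.restrict ?_
    filter_upwards [(ae_restrict_iff' measurableSet_Iio).2 b2, ae_restrict_of_ae c] with x h1 h2
    rwa [Real.norm_of_nonneg h2]
  rw [← intervalIntegral.integral_Iic_add_Ioi (b := 0)
    ((integrableOn_Iic_iff_integrableOn_Iio enorm_ne_top).2 j2) j1, integral_Iic_eq_integral_Iio,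
    integral_Iic_eq_integral_Iio]
  exact add_le_add
    (setIntegral_mono_on_ae j2 hWi.integrableOn measurableSet_Iio b2)
    (setIntegral_mono_on_ae j1 i2 measurableSet_Ioi b1)

/-! ### Negative eigenvalues of the Hamiltonian -/

theorem exists_negative_eigenvalue {θ η : ℝ} {W : Lp ℝ ∞ (volume : Measure ℝ)}
    (hW : ∀ᵐ x : ℝ, 0 ≤ W x) (hWi : Integrable W volume) (hηθ : η * θ < 0)
    (hW_int : ∫ x in Set.Ioi (0 : ℝ), (W (-x) + θ ^ 2 * W x) < |η * θ| / 2) :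
    ∃ E : ℝ, E < 0 ∧ IsEigenvalue (hamiltonian θ η W) (E : ℂ) := by
  have hθ : θ ≠ 0 := by rintro rfl; simp at hηθ
  have hη : η ≠ 0 := by rintro rfl; simp at hηθ
  rw [abs_of_neg hηθ] at hW_int
  set c : ℝ := -(η * θ) with hc_def
  have hc : 0 < c := by linarith
  -- with this decay rate, the kinetic part `κ₁ (1 + θ²)` of the energy of the trial function
  -- is `c / 2`
  set κ₁ : ℝ := c / (2 * (1 + θ ^ 2)) with hκ₁_def
  have hκ₁ : 0 < κ₁ := by positivity
  have hκ₁e : κ₁ * (1 + θ ^ 2) = c / 2 := by rw [hκ₁_def]; field_simp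
  have hκ₁c : κ₁ ≤ c := by nlinarith [mul_nonneg hκ₁.le (sq_nonneg θ)]
  have hv := mem_formDomain (θ := θ) (isWeakDeriv_twoSidedExp hκ₁ 1 θ)
    (hasLeftValue_twoSidedExp hκ₁ 1 θ) (hasRightValue_twoSidedExp hκ₁ 1 θ) (by simp)
  obtain ⟨κ, hκ, u, hu1, hu2⟩ := exists_solution_inner_eq_inv (energyOp θ W) (massOp θ)
    (traceVec θ) hc hκ₁ hκ₁c
    (fun u v => by
      rw [inner_energyOp, ← inner_conj_symm u, inner_energyOp, map_add, inner_conj_symm,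
        inner_conj_symm, potentialOp_symm])
    (fun u v => by rw [inner_massOp, ← inner_conj_symm u, inner_massOp, inner_conj_symm])
    (fun κ hκ => ⟨min 1 (κ ^ 2), lt_min one_pos (by positivity), fun u => by
      rw [re_inner_form_self, norm_sq_formDomain]
      have h0 := re_inner_potentialOp_self_nonneg hW (formFst θ u)
      nlinarith [mul_le_mul_of_nonneg_right (min_le_left 1 (κ ^ 2)) (sq_nonneg ‖formSnd θ u‖),
        mul_le_mul_of_nonneg_right (min_le_right 1 (κ ^ 2)) (sq_nonneg ‖formFst θ u‖)]⟩)
    (fun u => by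
      rw [re_inner_form_self, inner_traceVec]
      have h0 := re_inner_potentialOp_self_nonneg hW (formFst θ u)
      have hw := isWeakDeriv_formDomain u
      rw [hw.hasLeftValue_leftTrace.unique (hw.hasLeftValue hc), le_div_iff₀ hc]
      have h1 := norm_inner_le_norm (𝕜 := ℂ) (twoSidedExp c 1 0)
        ((c : ℂ) • formFst θ u + formSnd θ u)
      have h2 := norm_add_le ((c : ℂ) • formFst θ u) (formSnd θ u)
      rw [norm_smul, Complex.norm_real, Real.norm_of_nonneg hc.le] at h2
      have h3 := norm_sq_twoSidedExp hc
      set N := ‖(c : ℂ) • formFst θ u + formSnd θ u‖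
      have h4 : N ^ 2 ≤ 2 * (c ^ 2 * ‖formFst θ u‖ ^ 2 + ‖formSnd θ u‖ ^ 2) := by
        have := pow_le_pow_left₀ (norm_nonneg _) h2 2
        nlinarith [sq_nonneg (c * ‖formFst θ u‖ - ‖formSnd θ u‖)]
      have h5 := pow_le_pow_left₀ (norm_nonneg _) h1 2
      rw [mul_pow] at h5
      calc _ ≤ ‖twoSidedExp c 1 0‖ ^ 2 * N ^ 2 * c := mul_le_mul_of_nonneg_right h5 hc.le
        _ = N ^ 2 / 2 * (2 * c * ‖twoSidedExp c 1 0‖ ^ 2) := by ring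
        _ = N ^ 2 / 2 := by rw [h3, mul_one]
        _ ≤ _ := by linarith)
    (v := ⟨_, hv⟩)
    (by
      rw [inner_traceVec]
      exact ((isWeakDeriv_twoSidedExp hκ₁ 1 θ).hasLeftValue_leftTrace.unique
        (hasLeftValue_twoSidedExp hκ₁ 1 θ)).trans Complex.ofReal_one)
    (by
      rw [re_inner_form_self]
      have h1 := energy_twoSidedExp hκ₁ θ
      have h2 := re_inner_potentialOp_twoSidedExp_le hW hWi hκ₁ θ
      change (inner ℂ (potentialOp W (twoSidedExp κ₁ 1 θ)) (twoSidedExp κ₁ 1 θ)).re +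
        ‖twoSidedExp κ₁ (κ₁ * 1) (-(κ₁ * θ))‖ ^ 2 + κ₁ ^ 2 * ‖twoSidedExp κ₁ 1 θ‖ ^ 2 ≤ c
      linarith)
  exact ⟨-κ ^ 2, by have := pow_pos hκ 2; linarith, isEigenvalue_of_form_eq hθ hη hu1 hu2⟩

/-- Without potential the eigenfunction is `e^{κx}` for `x < 0` and `θ e^{-κx}` for `x > 0`, with
`κ = |ηθ| / (θ² + 1)`. -/
theorem isEigenvalue_hamiltonian_zero {θ η : ℝ} (hηθ : η * θ < 0) :
    IsEigenvalue (hamiltonian θ η 0)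
      ((-(η ^ 2 * θ ^ 2) / (θ ^ 2 + 1) ^ 2 : ℝ) : ℂ) := by
  have hθ : θ ≠ 0 := by rintro rfl; simp at hηθ
  set κ : ℝ := -(η * θ) / (θ ^ 2 + 1) with hκ_def
  have hκ : 0 < κ := div_pos (by linarith) (by positivity)
  have hE : -(η ^ 2 * θ ^ 2) / (θ ^ 2 + 1) ^ 2 = -κ ^ 2 := by
    rw [hκ_def]; field_simp
  have hl := hasLeftValue_twoSidedExp hκ 1 θ
  refine isEigenvalue_hamiltonian_iff.2 ⟨twoSidedExp κ 1 θ, _, _, ⟨isWeakDeriv_twoSidedExp hκ 1 θ,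
    isWeakDeriv_isWeakDeriv_twoSidedExp hκ 1 θ, _, _, _, _, hl,
    hasRightValue_twoSidedExp hκ 1 θ, hasLeftValue_twoSidedExp hκ _ _,
    hasRightValue_twoSidedExp hκ _ _, by simp, ?_⟩, ?_, ?_⟩
  · have : -(κ * θ) = θ⁻¹ * (κ * 1) + η * 1 := by
      rw [hκ_def]; field_simp; ring
    exact_mod_cast this
  · intro h0
    rw [h0] at hl
    have h2 : HasLeftValue 0 0 := by simpa using hl.smul 0
    have h3 := hl.unique h2
    simp at h3
  · have h0 : potentialOp 0 (twoSidedExp κ 1 θ) = 0 := Lp.zero_smul ℝ ∞ _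
    rw [h0, hE]
    push_cast
    module

end PointInteraction

end

theorem mainTheorem7 (θ η : ℝ) (W : Lp ℝ ∞ (volume : Measure ℝ))
    (hW_nonneg : ∀ᵐ x : ℝ, 0 ≤ W x)
    (hW_supp : ∃ K : Set ℝ, IsCompact K ∧ ∀ᵐ x : ℝ, x ∉ K → W x = 0)
    (hηθ : η * θ < 0)
    (hW_int : ∫ x in Set.Ioi (0 : ℝ), (W (-x) + θ ^ 2 * W x) < |η * θ| / 2) :
    ∃ E : ℝ, E < 0 ∧ PointInteraction.IsEigenvalue (PointInteraction.hamiltonian θ η W) (E : ℂ) ∧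
      (∀ E' : ℝ, E' < 0 →
        PointInteraction.IsEigenvalue (PointInteraction.hamiltonian θ η W) (E' : ℂ) → E' = E) ∧
      (W = 0 → E = -(η ^ 2 * θ ^ 2) / (θ ^ 2 + 1) ^ 2) := by
  have hθ : θ ≠ 0 := by rintro rfl; simp at hηθ
  obtain ⟨E, hE, h⟩ := PointInteraction.exists_negative_eigenvalue hW_nonneg
    (PointInteraction.integrable_of_compact_support hW_supp) hηθ hW_int
  refine ⟨E, hE, h, fun E' hE' h' =>
    PointInteraction.negative_eigenvalue_unique hθ hW_nonneg hE hE' h h', ?_⟩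
  rintro rfl
  refine PointInteraction.negative_eigenvalue_unique hθ hW_nonneg ?_ hE
    (PointInteraction.isEigenvalue_hamiltonian_zero hηθ) h
  have : 0 < η ^ 2 * θ ^ 2 := by rw [← mul_pow]; exact sq_pos_of_neg hηθ
  exact div_neg_of_neg_of_pos (by linarith) (by positivity)
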